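/- Let $p\ge 1$ and $q\ge 2$ be integers, put $n=p+q-2$, let $\epsilon_i=1$ for $1\le i\le p-1$ and $\epsilon_i=-1$ for $p\le i\le n$, and let $\mathfrak g=\mathfrak{so}(p,q)\otimes_{\mathbb R}\mathbb C$ be the complexified Lie algebra of the orthogonal group of the quadratic form $2x_0x_{n+1}+\sum_{i=1}^n\epsilon_i x_i^2$ of signature $(p,q)$ on $\mathbb R^{n+2}$. Let $\mathfrak p\subset\mathfrak g$ be the parabolic subalgebra that stabilizes the line spanned by the isotropic vector $e_0={}^t(1,0,\dots,0)$. For $\lambda\in\mathbb C$ let $\mathbb C_\lambda$ be the one-dimensional $\mathfrak p$-module on which $X\in\mathfrak p$ acts by $\lambda X_{00}$, where $Xe_0=X_{00}e_0$, and let $$M_{\mathfrak p}^{\mathfrak g}(\lambda)=U(\mathfrak g)\otimes_{U(\mathfrak p)}\mathbb C_\lambda$$ be the corresponding scalar generalized Verma module. Write $\mathbb N=\{0,1,2,\dots\}$ and $\mathbb N_+=\{1,2,\dots\}$. If $n$ is even, then $M_{\mathfrak p}^{\mathfrak g}(\lambda)$ is irreducible if and only if $\frac n2+\lambda\notin\mathbb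 N_+$. If $n$ is odd, then $M_{\mathfrak p}^{\mathfrak g}(\lambda)$ is irreducible if and only if $\lambda\notin\mathbb N$ and $\frac n2+\lambda\notin\mathbb N_+$. -/

import Mathlib

open scoped TensorProduct

noncomputable section

attribute [local instance 100] LieRing.ofAssociativeRing

/-! ### Generalized Verma modules -/

section Verma

variable {g : Type*} [LieRing g] [LieAlgebra ℂ g]

/-- The algebra homomorphism `U(p) → U(g)` induced by the inclusion of a subalgebra `p` of `g`. -/
def envelopingIncl (p : LieSubalgebra ℂ g) :
    UniversalEnvelopingAlgebra ℂ p →ₐ[ℂ] UniversalEnvelopingAlgebra ℂ g :=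
  UniversalEnvelopingAlgebra.lift ℂ ((UniversalEnvelopingAlgebra.ι ℂ).comp p.incl)

variable {V : Type*} [AddCommGroup V] [Module ℂ V]

/-- For a representation `ρ` of `p` on `V`, the left `U(g)`-submodule of `U(g) ⊗_ℂ V` spanned by
the elements `u a ⊗ v - u ⊗ a v` with `u ∈ U(g)`, `a ∈ U(p)`, `v ∈ V`. -/
def balancedRelations (p : LieSubalgebra ℂ g) (ρ : p →ₗ⁅ℂ⁆ Module.End ℂ V) :
    Submodule (UniversalEnvelopingAlgebra ℂ g) (UniversalEnvelopingAlgebra ℂ g ⊗[ℂ] V) :=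
  Submodule.span (UniversalEnvelopingAlgebra ℂ g)
    {t | ∃ (u : UniversalEnvelopingAlgebra ℂ g) (a : UniversalEnvelopingAlgebra ℂ p) (v : V),
      t = (u * envelopingIncl p a) ⊗ₜ[ℂ] v -
        u ⊗ₜ[ℂ] (UniversalEnvelopingAlgebra.lift ℂ ρ a v)}

/-- The generalized Verma module `U(g) ⊗_{U(p)} V`, a left `U(g)`-module: the balanced tensor
product over the noncommutative ring `U(p)` is the quotient of `U(g) ⊗_ℂ V` by the relations
`u a ⊗ v = u ⊗ a v` for `a ∈ U(p)`. -/
abbrev GeneralizedVermaModule (p : LieSubalgebra ℂ g) (ρ : p →ₗ⁅ℂ⁆ Module.End ℂ V) : Type _ :=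
  (UniversalEnvelopingAlgebra ℂ g ⊗[ℂ] V) ⧸ balancedRelations p ρ

end Verma

/-! ### The conformal Lie algebra and its parabolic subalgebra -/

/-- Indices of the coordinates `x_0`, `(x_1, …, x_n)`, `x_{n+1}` of `ℝ^{p+q}`, `n = p + q - 2`. -/
abbrev ConfIdx (p q : ℕ) : Type := Unit ⊕ (Fin (p + q - 2) ⊕ Unit)

/-- The index of the coordinate `x_0`. -/
abbrev idxZero {p q : ℕ} : ConfIdx p q := Sum.inl ()

/-- The signs `ε_1, …, ε_n`: the first `p - 1` are `1`, the other `q - 1` are `-1`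
(here the index `i` starts at `0`). -/
def confSign (p q : ℕ) (R : Type*) [CommRing R] (i : Fin (p + q - 2)) : R :=
  if (i : ℕ) + 1 ≤ p - 1 then 1 else -1

/-- The Gram matrix of the quadratic form `2 x_0 x_{n+1} + ∑ ε_i x_i ^ 2`, of signature `(p, q)`. -/
def confForm (p q : ℕ) (R : Type*) [CommRing R] : Matrix (ConfIdx p q) (ConfIdx p q) R :=
  Matrix.of fun a b =>
    match a, b with
    | Sum.inl _, Sum.inr (Sum.inr _) => 1
    | Sum.inr (Sum.inr _), Sum.inl _ => 1
    | Sum.inr (Sum.inl i), Sum.inr (Sum.inl j) => if i = j then confSign p q R i else 0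
    | _, _ => 0

/-- The Lie algebra of the matrices `X` with `Xᵀ J + J X = 0`, where `J = confForm p q R`.
For `R = ℝ` it is `so(p, q)`, for `R = ℂ` it is the complexification of `so(p, q)`. -/
abbrev soLie (p q : ℕ) (R : Type*) [CommRing R] :
    LieSubalgebra R (Matrix (ConfIdx p q) (ConfIdx p q) R) :=
  skewAdjointMatricesLieSubalgebra (confForm p q R)

/-- The complex Lie algebra `soLie p q ℂ` is `so(p, q) ⊕ i so(p, q)`. -/
theorem mem_soLie_complex_iff (p q : ℕ) (X : Matrix (ConfIdx p q) (ConfIdx p q) ℂ) :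
    X ∈ soLie p q ℂ ↔
      X.map Complex.re ∈ soLie p q ℝ ∧ X.map Complex.im ∈ soLie p q ℝ := by
  have hJ : ∀ a b, confForm p q ℂ a b = ((confForm p q ℝ a b : ℝ) : ℂ) := by
    rintro (_ | _ | _) (_ | _ | _) <;> simp [confForm, confSign]
    split_ifs <;> simp
  simp only [mem_skewAdjointMatricesLieSubalgebra, mem_skewAdjointMatricesSubmodule,
    Matrix.IsSkewAdjoint, Matrix.IsAdjointPair]
  simp only [← Matrix.ext_iff, Matrix.mul_apply, hJ, Complex.ext_iff, Matrix.transpose_apply,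
    Matrix.map_apply, Matrix.neg_apply, Complex.re_sum, Complex.im_sum, Complex.mul_re,
    Complex.mul_im, Complex.ofReal_re, Complex.ofReal_im, Complex.neg_re, Complex.neg_im]
  simp [forall_and]

/-- The parabolic subalgebra of the complexification of `so(p, q)`: the stabilizer of the isotropic
line spanned by `e_0`, i.e. the matrices whose column with index `0` is a multiple of `e_0`. -/
def confParabolic (p q : ℕ) : LieSubalgebra ℂ (soLie p q ℂ) where
  carrier := {X | ∀ i, i ≠ idxZero → (X : Matrix (ConfIdx p q) (ConfIdx p q) ℂ) i idxZero = 0}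
  add_mem' := by
    intro X Y hX hY i hi
    simp [hX i hi, hY i hi]
  zero_mem' := by
    intro i _
    simp
  smul_mem' := by
    intro c X hX i hi
    simp [hX i hi]
  lie_mem' := by
    intro X Y hX hY i hi
    have hX' := hX i hi
    have hY' := hY i hi
    rw [LieSubalgebra.coe_bracket, Ring.lie_def, Matrix.sub_apply, Matrix.mul_apply,
      Matrix.mul_apply, Finset.sum_eq_single idxZero, Finset.sum_eq_single idxZero, hX', hY']
    · simp
    · intro j _ hj
      rw [hX j hj, mul_zero]
    · simp
    · intro j _ hj
      rw [hY j hj, mul_zero]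
    · simp

/-- The one-dimensional representation `ℂ_lam` of the parabolic subalgebra, the differential of the
character `a ^ lam` of the parabolic subgroup, where `a` is the entry with index `(0, 0)`: the
element `X` acts on `ℂ` by the scalar `lam * X_{00}`. -/
def confCharacter (p q : ℕ) (lam : ℂ) : confParabolic p q →ₗ⁅ℂ⁆ Module.End ℂ ℂ where
  toFun X := (lam * (X : Matrix (ConfIdx p q) (ConfIdx p q) ℂ) idxZero idxZero) •
    (1 : Module.End ℂ ℂ)
  map_add' := by
    intro X Y
    simp [mul_add, add_smul]
  map_smul' := by
    intro c X
    simp [smul_smul, mul_left_comm]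
  map_lie' := by
    intro X Y
    have h : ((⁅X, Y⁆ : confParabolic p q) : Matrix (ConfIdx p q) (ConfIdx p q) ℂ)
        idxZero idxZero = 0 := by
      rw [LieSubalgebra.coe_bracket, LieSubalgebra.coe_bracket, Ring.lie_def, Matrix.sub_apply,
        Matrix.mul_apply, Matrix.mul_apply, Finset.sum_eq_single idxZero,
        Finset.sum_eq_single idxZero]
      · ring
      · intro j _ hj
        rw [X.2 j hj, mul_zero]
      · simp
      · intro j _ hj
        rw [Y.2 j hj, mul_zero]
      · simp
    rw [h, Ring.lie_def]
    ext
    simp [mul_comm]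

/-- The scalar generalized Verma module `M(lam) = U(g) ⊗_{U(p)} ℂ_lam`. -/
abbrev ScalarVermaModule (p q : ℕ) (lam : ℂ) : Type :=
  GeneralizedVermaModule (confParabolic p q) (confCharacter p q lam)

end

/-! The opposite nilradical is abelian of dimension `n`, so the module is modelled on polynomials in
`ξ_1, …, ξ_n`: the opposite nilradical acts by multiplication, the grading element by `lam - E`, the
rest of the Levi factor by first-order operators `ξ_i ∂_j`, and the nilradical by the second-order
Bessel operators `B_j`. PBW is not needed. Polynomials map to `U(g)`, the same commutation relations
hold on both sides (`confOp_X_mul`, `ι_smul_polynomial_smul`), and acting on `1` recovers the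
polynomial (`isSimpleModule_scalarVermaModule_iff`).

A nonzero element of least degree in an invariant subspace is homogeneous and killed by every `B_j`.
Hence reducibility amounts to a nonzero homogeneous `f` of degree `m + 1 > 0` with `(lam - m) ∂_j f
+ (ε_j / 2) ξ_j Δ f = 0` for all `j`. If `lam ≠ m`, applying `∑ ε_j ∂_j` forces `2 lam = m + 1 - n`.
Eliminating `Δ f` shows that `f` is invariant under infinitesimal rotations, hence of even degree
when `n ≥ 2`, and then `n / 2 + lam` is a positive integer (`parameter_of_besselOp_eq_zero`). For `n
= 1` an odd degree is possible and gives `lam ∈ ℕ`.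

Conversely, `Q ^ (k + 1)` with `Q = ∑ ε_i ξ_i ^ 2` is singular when `n / 2 + lam = k + 1`. For `lam
= m`, so is the power `m + 1` of an isotropic linear form if `n ≥ 2`, and `ξ ^ (2 m + 1)` if `n =
1`. For even `n` the condition `lam ∈ ℕ` is absorbed by the other one. -/

section

attribute [local instance 100] LieRing.ofAssociativeRing

/-! ### Bessel operators on polynomials -/

section Bessel

open MvPolynomial

variable {σ : Type*} [Fintype σ] (ε : σ → ℂ) (lam : ℂ)

/-- The Euler operator `∑ ξ_i ∂_i`. -/
noncomputable def eulerOp (σ : Type*) [Fintype σ] : Module.End ℂ (MvPolynomial σ ℂ) :=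
  ∑ i, LinearMap.mulLeft ℂ (X i) ∘ₗ (pderiv i).toLinearMap

/-- The Laplacian `∑ ε_i ∂_i ^ 2`. -/
noncomputable def signedLaplacian : Module.End ℂ (MvPolynomial σ ℂ) :=
  ∑ i, ε i • ((pderiv i).toLinearMap ∘ₗ (pderiv i).toLinearMap)

/-- The Bessel operator `(lam - E) ∂_j + (1 / 2) ε_j ξ_j Δ`. -/
noncomputable def besselOp (j : σ) : Module.End ℂ (MvPolynomial σ ℂ) :=
  lam • (pderiv j).toLinearMap - eulerOp σ ∘ₗ (pderiv j).toLinearMap +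
    (ε j / 2) • (LinearMap.mulLeft ℂ (X j) ∘ₗ signedLaplacian ε)

theorem eulerOp_apply (f : MvPolynomial σ ℂ) : eulerOp σ f = ∑ i, X i * pderiv i f := by
  simp [eulerOp]

theorem signedLaplacian_apply (f : MvPolynomial σ ℂ) :
    signedLaplacian ε f = ∑ i, ε i • pderiv i (pderiv i f) := by
  simp [signedLaplacian]

theorem besselOp_apply (j : σ) (f : MvPolynomial σ ℂ) :
    besselOp ε lam j f = lam • pderiv j f - eulerOp σ (pderiv j f) +
      (ε j / 2) • (X j * signedLaplacian ε f) := by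
  simp [besselOp]

theorem eulerOp_X_mul (i : σ) (f : MvPolynomial σ ℂ) :
    eulerOp σ (X i * f) = X i * eulerOp σ f + X i * f := by
  classical
  simp only [eulerOp_apply, pderiv_mul, pderiv_X, Pi.single_apply, mul_add, Finset.sum_add_distrib,
    Finset.mul_sum]
  rw [add_comm]
  congr 1
  · exact Finset.sum_congr rfl fun _ _ => by ring
  · simp

theorem signedLaplacian_X_mul (i : σ) (f : MvPolynomial σ ℂ) :
    signedLaplacian ε (X i * f) = X i * signedLaplacian ε f + (2 * ε i) • pderiv i f := by
  classical
  have h (k : σ) : pderiv k (pderiv k (X i * f)) =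
      X i * pderiv k (pderiv k f) + (if i = k then (2 : ℂ) • pderiv k f else 0) := by
    simp only [pderiv_mul, pderiv_X, Pi.single_apply]
    split_ifs with h
    · simp only [one_mul, map_add, pderiv_mul, pderiv_X, Pi.single_apply, h, if_true, two_smul]
      ring
    · simp [pderiv_X, h]
  simp only [signedLaplacian_apply, h, smul_add, Finset.sum_add_distrib, Finset.mul_sum,
    mul_smul_comm, smul_ite, smul_zero, Finset.sum_ite_eq, Finset.mem_univ, if_true, smul_smul]
  rw [mul_comm (ε i)]

/-- The commutator of `B_j` with `ξ_i` has first order: it is the action of the bracket of a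
nilradical element with an opposite one, which lies in the Levi factor. -/
theorem besselOp_X_mul [DecidableEq σ] (i j : σ) (f : MvPolynomial σ ℂ) :
    besselOp ε lam j (X i * f) = X i * besselOp ε lam j f +
      ((if i = j then lam • f - eulerOp σ f else 0) - X i * pderiv j f +
        (ε i * ε j) • (X j * pderiv i f)) := by
  have h : pderiv j (X i * f) = X i * pderiv j f + if i = j then f else 0 := by
    simp only [pderiv_mul, pderiv_X, Pi.single_apply]
    split_ifs <;> simp [add_comm]
  rw [besselOp_apply, besselOp_apply, h, signedLaplacian_X_mul, map_add, eulerOp_X_mul]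
  simp only [smul_eq_C_mul, mul_add, map_mul, map_ofNat]
  have h2 : (C (ε j / 2) : MvPolynomial σ ℂ) * 2 = C (ε j) := by
    rw [← map_ofNat (C : ℂ →+* MvPolynomial σ ℂ), ← map_mul]; congr 1; simp
  rw [← h2]
  split_ifs
  · ring
  · simp only [map_zero]; ring

theorem besselOp_C (j : σ) (c : ℂ) : besselOp ε lam j (C c) = 0 := by
  simp [besselOp_apply, signedLaplacian_apply]

theorem eulerOp_C (c : ℂ) : eulerOp σ (C c) = 0 := by
  simp [eulerOp_apply]

end Bessel

/-! ### The action of the conformal Lie algebra on polynomials -/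

section ConformalAction

open MvPolynomial

variable {p q : ℕ}

/-- The index of the coordinate `x_i`, `1 ≤ i ≤ n`. -/
abbrev idxMid (i : Fin (p + q - 2)) : ConfIdx p q := Sum.inr (Sum.inl i)

/-- The index of the coordinate `x_{n+1}`. -/
abbrev idxLast : ConfIdx p q := Sum.inr (Sum.inr ())

theorem confSign_mul_self (i : Fin (p + q - 2)) : confSign p q ℂ i * confSign p q ℂ i = 1 := by
  unfold confSign; split_ifs <;> simp

theorem confForm_zero_mul (Z : Matrix (ConfIdx p q) (ConfIdx p q) ℂ) (b : ConfIdx p q) :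
    (confForm p q ℂ * Z) idxZero b = Z idxLast b := by
  simp [Matrix.mul_apply, confForm]

theorem confForm_mid_mul (Z : Matrix (ConfIdx p q) (ConfIdx p q) ℂ) (i : Fin (p + q - 2))
    (b : ConfIdx p q) :
    (confForm p q ℂ * Z) (idxMid i) b = confSign p q ℂ i * Z (idxMid i) b := by
  simp [Matrix.mul_apply, confForm]

theorem confForm_last_mul (Z : Matrix (ConfIdx p q) (ConfIdx p q) ℂ) (b : ConfIdx p q) :
    (confForm p q ℂ * Z) idxLast b = Z idxZero b := by
  simp [Matrix.mul_apply, confForm]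

theorem confForm_transpose : (confForm p q ℂ).transpose = confForm p q ℂ := by
  ext (_ | i | _) (_ | j | _) <;> simp only [confForm, Matrix.transpose_apply, Matrix.of_apply]
  by_cases h : i = j
  · subst h; rfl
  · simp [h, Ne.symm h]

theorem mem_soLie_iff {Z : Matrix (ConfIdx p q) (ConfIdx p q) ℂ} :
    Z ∈ soLie p q ℂ ↔
      ∀ a b, (confForm p q ℂ * Z) b a = -(confForm p q ℂ * Z) a b := by
  have h : Z.transpose * confForm p q ℂ = (confForm p q ℂ * Z).transpose := by
    rw [Matrix.transpose_mul, confForm_transpose]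
  rw [mem_skewAdjointMatricesLieSubalgebra, mem_skewAdjointMatricesSubmodule,
    Matrix.IsSkewAdjoint, Matrix.IsAdjointPair, h, ← Matrix.ext_iff]
  simp

theorem soLie_last_zero (Z : soLie p q ℂ) : Z.1 idxLast idxZero = 0 := by
  have h := mem_soLie_iff.1 Z.2 idxZero idxZero
  rw [confForm_zero_mul] at h
  linear_combination h / 2

theorem soLie_zero_last (Z : soLie p q ℂ) : Z.1 idxZero idxLast = 0 := by
  have h := mem_soLie_iff.1 Z.2 idxLast idxLast
  rw [confForm_last_mul] at h
  linear_combination h / 2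

theorem soLie_last_mid (Z : soLie p q ℂ) (i : Fin (p + q - 2)) :
    Z.1 idxLast (idxMid i) = -(confSign p q ℂ i * Z.1 (idxMid i) idxZero) := by
  have h := mem_soLie_iff.1 Z.2 (idxMid i) idxZero
  rwa [confForm_zero_mul, confForm_mid_mul] at h

theorem soLie_mid_last (Z : soLie p q ℂ) (i : Fin (p + q - 2)) :
    Z.1 (idxMid i) idxLast = -(confSign p q ℂ i * Z.1 idxZero (idxMid i)) := by
  have h := mem_soLie_iff.1 Z.2 (idxMid i) idxLast
  rw [confForm_last_mul, confForm_mid_mul] at h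
  linear_combination (confSign p q ℂ i) * h - (Z.1 (idxMid i) idxLast) * confSign_mul_self i

theorem soLie_coe_lie (Y Z : soLie p q ℂ) (a b : ConfIdx p q) :
    (⁅Y, Z⁆ : soLie p q ℂ).1 a b =
      ∑ c, Y.1 a c * Z.1 c b - ∑ c, Z.1 a c * Y.1 c b := by
  rw [LieSubalgebra.coe_bracket, Ring.lie_def, Matrix.sub_apply, Matrix.mul_apply, Matrix.mul_apply]

/-- The matrix with column `w` under the entry `(0, 0)` in the opposite nilradical. -/
def loweringMatrix (w : Fin (p + q - 2) → ℂ) : Matrix (ConfIdx p q) (ConfIdx p q) ℂ :=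
  Matrix.of fun a b =>
    match a, b with
    | Sum.inr (Sum.inl i), Sum.inl _ => w i
    | Sum.inr (Sum.inr _), Sum.inr (Sum.inl i) => -(confSign p q ℂ i * w i)
    | _, _ => 0

theorem loweringMatrix_mem (w : Fin (p + q - 2) → ℂ) : loweringMatrix w ∈ soLie p q ℂ := by
  rw [mem_soLie_iff]
  rintro (⟨⟨⟩⟩ | i | ⟨⟨⟩⟩) (⟨⟨⟩⟩ | j | ⟨⟨⟩⟩) <;>
  simp [confForm_zero_mul, confForm_mid_mul, confForm_last_mul, loweringMatrix]

/-- The element of the opposite nilradical with column `w` under the entry `(0, 0)`. -/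
def loweringElt (w : Fin (p + q - 2) → ℂ) : soLie p q ℂ := ⟨loweringMatrix w, loweringMatrix_mem w⟩

/-- The operator by which a matrix `Z` acts on polynomials. -/
noncomputable def confOp (lam : ℂ) : Matrix (ConfIdx p q) (ConfIdx p q) ℂ →ₗ[ℂ]
    Module.End ℂ (MvPolynomial (Fin (p + q - 2)) ℂ) where
  toFun Z := ∑ i, Z (idxMid i) idxZero • LinearMap.mulLeft ℂ (X i) +
    Z idxZero idxZero • (lam • 1 - eulerOp _) +
    ∑ i, ∑ j, Z (idxMid i) (idxMid j) • (LinearMap.mulLeft ℂ (X i) ∘ₗ (pderiv j).toLinearMap) +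
    ∑ j, Z idxZero (idxMid j) • besselOp (confSign p q ℂ) lam j
  map_add' Y Z := by
    simp only [Matrix.add_apply, add_smul, Finset.sum_add_distrib]
    abel
  map_smul' c Z := by
    simp only [Matrix.smul_apply, smul_eq_mul, mul_smul, ← Finset.smul_sum, ← smul_add,
      RingHom.id_apply]

theorem confOp_apply (lam : ℂ) (Z : Matrix (ConfIdx p q) (ConfIdx p q) ℂ)
    (f : MvPolynomial (Fin (p + q - 2)) ℂ) :
    confOp lam Z f = ∑ i, Z (idxMid i) idxZero • (X i * f) +
      Z idxZero idxZero • (lam • f - eulerOp _ f) +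
      ∑ i, ∑ j, Z (idxMid i) (idxMid j) • (X i * pderiv j f) +
      ∑ j, Z idxZero (idxMid j) • besselOp (confSign p q ℂ) lam j f := by
  simp [confOp, LinearMap.sum_apply]

/-- The opposite nilradical acts by multiplication. -/
theorem confOp_loweringElt (lam : ℂ) (w : Fin (p + q - 2) → ℂ)
    (f : MvPolynomial (Fin (p + q - 2)) ℂ) :
    confOp lam (loweringElt w).1 f = ∑ i, w i • (X i * f) := by
  simp [confOp_apply, loweringElt, loweringMatrix]

theorem confOp_C (lam : ℂ) (Z : Matrix (ConfIdx p q) (ConfIdx p q) ℂ) (c : ℂ) :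
    confOp lam Z (C c) = ∑ i, Z (idxMid i) idxZero • (X i * C c) +
      (Z idxZero idxZero * lam) • C c := by
  simp [confOp_apply, besselOp_C, eulerOp_C, smul_smul]

/-- These four blocks are all that `confOp` reads; the remaining entries of a matrix in the Lie
algebra are determined by them. -/
theorem lie_loweringElt_entries (Z : soLie p q ℂ) (i : Fin (p + q - 2)) :
    (∀ k, (⁅Z, loweringElt (Pi.single i 1)⁆ : soLie p q ℂ).1 (idxMid k) idxZero =
      Z.1 (idxMid k) (idxMid i) - if i = k then Z.1 idxZero idxZero else 0) ∧
    (⁅Z, loweringElt (Pi.single i 1)⁆ : soLie p q ℂ).1 idxZero idxZero = Z.1 idxZero (idxMid i) ∧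
    (∀ k j, (⁅Z, loweringElt (Pi.single i 1)⁆ : soLie p q ℂ).1 (idxMid k) (idxMid j) =
      (if i = j then confSign p q ℂ i * confSign p q ℂ k * Z.1 idxZero (idxMid k) else 0) -
        if i = k then Z.1 idxZero (idxMid j) else 0) ∧
    ∀ j, (⁅Z, loweringElt (Pi.single i 1)⁆ : soLie p q ℂ).1 idxZero (idxMid j) = 0 := by
  simp only [soLie_coe_lie]
  refine ⟨fun k => ?_, ?_, fun k j => ?_, fun j => ?_⟩
  · simp [loweringElt, loweringMatrix, Pi.single_apply, eq_comm]
  · simp [loweringElt, loweringMatrix, Pi.single_apply]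
  · by_cases h : i = j
    · subst h
      simp [loweringElt, loweringMatrix, Pi.single_apply, soLie_mid_last, eq_comm]
      ring
    · simp [loweringElt, loweringMatrix, Pi.single_apply, eq_comm, h]
  · simp [loweringElt, loweringMatrix, soLie_zero_last]

/-- This is the relation `Z y_i = y_i Z + [Z, y_i]` of `U(g)`. Together with the values on constants
it determines all the operators, so later verifications are inductions on the polynomial. -/
theorem confOp_X_mul (lam : ℂ) (Z : soLie p q ℂ) (i : Fin (p + q - 2))
    (f : MvPolynomial (Fin (p + q - 2)) ℂ) :
    confOp lam Z.1 (X i * f) = X i * confOp lam Z.1 f +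
      confOp lam (⁅Z, loweringElt (Pi.single i 1)⁆ : soLie p q ℂ).1 f := by
  obtain ⟨h1, h2, h3, h4⟩ := lie_loweringElt_entries Z i
  have hd (j) : pderiv j (X i * f) = X i * pderiv j f + if i = j then f else 0 := by
    simp only [pderiv_mul, pderiv_X, Pi.single_apply]
    split_ifs <;> simp [add_comm]
  rw [confOp_apply, confOp_apply, confOp_apply]
  simp only [h1, h2, h3, h4, besselOp_X_mul, eulerOp_X_mul, hd, mul_add, smul_add, sub_smul,
    smul_sub, ite_smul, zero_smul, Finset.sum_add_distrib, Finset.sum_sub_distrib, mul_ite,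
    mul_zero, smul_ite, smul_zero, Finset.sum_ite_eq, Finset.mem_univ, if_true,
    Finset.mul_sum, smul_eq_C_mul, map_mul, Finset.sum_const_zero]
  have hs : ∑ x, C (Z.1 idxZero (idxMid x)) * (C (confSign p q ℂ i) * C (confSign p q ℂ x) *
      (X x * pderiv i f)) = ∑ x, C (confSign p q ℂ i) * C (confSign p q ℂ x) *
      C (Z.1 idxZero (idxMid x)) * (X x * pderiv i f) :=
    Finset.sum_congr rfl fun _ _ => by ring
  rw [hs]
  have hc : ∑ x, ∑ y, (if i = x then C (Z.1 idxZero (idxMid y)) * (X x * pderiv y f) else 0) =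
      ∑ y, C (Z.1 idxZero (idxMid y)) * (X i * pderiv y f) := by
    rw [Finset.sum_comm]
    simp
  have h5 : ∑ x, C (Z.1 (idxMid x) idxZero) * (X x * (X i * f)) =
      ∑ x, X i * (C (Z.1 (idxMid x) idxZero) * (X x * f)) :=
    Finset.sum_congr rfl fun _ _ => by ring
  have h6 : ∑ x, ∑ y, C (Z.1 (idxMid x) (idxMid y)) * (X x * (X i * pderiv y f)) =
      ∑ x, ∑ y, X i * (C (Z.1 (idxMid x) (idxMid y)) * (X x * pderiv y f)) :=
    Finset.sum_congr rfl fun _ _ => Finset.sum_congr rfl fun _ _ => by ring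
  have h7 : ∑ x, C (Z.1 idxZero (idxMid x)) * (X i * besselOp (confSign p q ℂ) lam x f) =
      ∑ x, X i * (C (Z.1 idxZero (idxMid x)) * besselOp (confSign p q ℂ) lam x f) :=
    Finset.sum_congr rfl fun _ _ => by ring
  rw [hc, h5, h6, h7]
  ring

theorem confOp_C_eq_add (lam : ℂ) (Z : Matrix (ConfIdx p q) (ConfIdx p q) ℂ) (c : ℂ) :
    confOp lam Z (C c) = (∑ i, C (Z (idxMid i) idxZero) * X i) * C c +
      C (Z idxZero idxZero) * C lam * C c := by
  rw [confOp_C]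
  simp only [smul_eq_C_mul, map_mul, Finset.sum_mul, mul_assoc]

theorem confOp_confOp_C (lam : ℂ) (Y Z : soLie p q ℂ) (c : ℂ) :
    confOp lam Y.1 (confOp lam Z.1 (C c)) =
      ((∑ i, C (Z.1 (idxMid i) idxZero) * X i) + C (Z.1 idxZero idxZero) * C lam) *
        confOp lam Y.1 (C c) +
      (∑ k, (∑ i, C (Y.1 (idxMid k) (idxMid i)) * C (Z.1 (idxMid i) idxZero)) * X k) * C c -
      C (Y.1 idxZero idxZero) * (∑ i, C (Z.1 (idxMid i) idxZero) * X i) * C c +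
      (∑ i, C (Y.1 idxZero (idxMid i)) * C (Z.1 (idxMid i) idxZero)) * C lam * C c := by
  have h (i) : confOp lam (⁅Y, loweringElt (Pi.single i 1)⁆ : soLie p q ℂ).1 (C c) =
      (∑ k, C (Y.1 (idxMid k) (idxMid i)) * X k) * C c - C (Y.1 idxZero idxZero) * X i * C c +
        C (Y.1 idxZero (idxMid i)) * C lam * C c := by
    obtain ⟨h1, h2, -, -⟩ := lie_loweringElt_entries Y i
    rw [confOp_C_eq_add, h2]
    simp only [h1, map_sub, sub_mul, Finset.sum_sub_distrib]
    simp [apply_ite C, ite_mul]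
  rw [confOp_C lam Z.1]
  simp only [map_add, map_sum, map_smul, confOp_X_mul, h]
  simp only [smul_eq_C_mul, map_mul]
  have h2 : ∑ k, (∑ i, C (Y.1 (idxMid k) (idxMid i)) * C (Z.1 (idxMid i) idxZero)) *
      (X k : MvPolynomial (Fin (p + q - 2)) ℂ) =
      ∑ i, C (Z.1 (idxMid i) idxZero) * ∑ k, C (Y.1 (idxMid k) (idxMid i)) * X k := by
    simp only [Finset.sum_mul, Finset.mul_sum]
    rw [Finset.sum_comm]
    exact Finset.sum_congr rfl fun _ _ => Finset.sum_congr rfl fun _ _ => by ring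
  rw [h2, add_mul, Finset.sum_mul, Finset.sum_mul, Finset.mul_sum, Finset.sum_mul, Finset.sum_mul,
    Finset.sum_mul]
  have h3 (a b c d e : MvPolynomial (Fin (p + q - 2)) ℂ) :
      a + b + c - d + e = (a + c - d + e) + b := by
    ring
  rw [h3, ← Finset.sum_add_distrib, ← Finset.sum_sub_distrib, ← Finset.sum_add_distrib]
  congr 1
  exact Finset.sum_congr rfl fun _ _ => by ring

/-- Base case of the representation property: in the difference of the two composites the part
symmetric in `Y` and `Z` cancels, and the rest is read off from the matrix commutator. -/
theorem confOp_lie_C (lam : ℂ) (Y Z : soLie p q ℂ) (c : ℂ) :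
    confOp lam (⁅Y, Z⁆ : soLie p q ℂ).1 (C c) =
      confOp lam Y.1 (confOp lam Z.1 (C c)) - confOp lam Z.1 (confOp lam Y.1 (C c)) := by
  have h0 : (⁅Y, Z⁆ : soLie p q ℂ).1 idxZero idxZero =
      ∑ i, Y.1 idxZero (idxMid i) * Z.1 (idxMid i) idxZero -
      ∑ i, Z.1 idxZero (idxMid i) * Y.1 (idxMid i) idxZero := by
    rw [soLie_coe_lie]
    simp [soLie_zero_last]
    ring
  have hk (k) : (⁅Y, Z⁆ : soLie p q ℂ).1 (idxMid k) idxZero =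
      Y.1 (idxMid k) idxZero * Z.1 idxZero idxZero +
        ∑ i, Y.1 (idxMid k) (idxMid i) * Z.1 (idxMid i) idxZero -
      (Z.1 (idxMid k) idxZero * Y.1 idxZero idxZero +
        ∑ i, Z.1 (idxMid k) (idxMid i) * Y.1 (idxMid i) idxZero) := by
    rw [soLie_coe_lie]
    simp [soLie_last_zero]
  rw [confOp_confOp_C, confOp_confOp_C]
  simp only [confOp_C_eq_add, h0, hk, map_sub, map_add, map_sum, map_mul, sub_mul, add_mul,
    Finset.sum_sub_distrib, Finset.sum_add_distrib]
  have h1 (Y Z : soLie p q ℂ) : ∑ i, C (Y.1 (idxMid i) idxZero) * C (Z.1 idxZero idxZero) *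
      (X i : MvPolynomial (Fin (p + q - 2)) ℂ) =
      C (Z.1 idxZero idxZero) * ∑ i, C (Y.1 (idxMid i) idxZero) * X i := by
    rw [Finset.mul_sum]
    exact Finset.sum_congr rfl fun _ _ => by ring
  rw [h1, h1]
  ring

theorem confOp_lie (lam : ℂ) (f : MvPolynomial (Fin (p + q - 2)) ℂ) (Y Z : soLie p q ℂ) :
    confOp lam (⁅Y, Z⁆ : soLie p q ℂ).1 f =
      confOp lam Y.1 (confOp lam Z.1 f) - confOp lam Z.1 (confOp lam Y.1 f) := by
  -- `Y` and `Z` must vary, since the step uses the hypothesis for their brackets with `y`.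
  induction f using MvPolynomial.induction_on generalizing Y Z with
  | C c => exact confOp_lie_C lam Y Z c
  | add f g hf hg => simp only [map_add, hf, hg]; abel
  | mul_X f i hf =>
    rw [mul_comm]
    set y : soLie p q ℂ := loweringElt (Pi.single i 1) with hy
    -- The Jacobi identity matches the correction terms left by commuting past `X i`.
    have hJ : confOp lam (⁅⁅Y, Z⁆, y⁆ : soLie p q ℂ).1 f =
        confOp lam (⁅Y, ⁅Z, y⁆⁆ : soLie p q ℂ).1 f -
          confOp lam (⁅Z, ⁅Y, y⁆⁆ : soLie p q ℂ).1 f := by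
      rw [lie_lie, ← LinearMap.sub_apply, ← map_sub]
      rfl
    simp only [confOp_X_mul, map_add, ← hy]
    rw [hf Y Z, hJ, hf Y ⁅Z, y⁆, hf Z ⁅Y, y⁆]
    ring

/-- The action of the conformal Lie algebra on polynomials. -/
noncomputable def confRep (p q : ℕ) (lam : ℂ) :
    soLie p q ℂ →ₗ⁅ℂ⁆ Module.End ℂ (MvPolynomial (Fin (p + q - 2)) ℂ) where
  toLinearMap := confOp lam ∘ₗ (soLie p q ℂ).toSubmodule.subtype
  map_lie' := by
    intro Y Z
    refine LinearMap.ext fun f => ?_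
    exact confOp_lie lam f Y Z

theorem confRep_apply (lam : ℂ) (Z : soLie p q ℂ) : confRep p q lam Z = confOp lam Z.1 := rfl

end ConformalAction

/-! ### The polynomial model of the scalar generalized Verma module -/

section EnvelopingInduction

variable {g : Type*} [LieRing g] [LieAlgebra ℂ g]

/-- The elements satisfying the motive form a subalgebra through which `ι` factors; by the universal
property, the induced map into it followed by the inclusion is the identity. -/
theorem UniversalEnvelopingAlgebra.induction_on_generators
    {motive : UniversalEnvelopingAlgebra ℂ g → Prop}
    (algebraMap : ∀ c : ℂ, motive (algebraMap ℂ _ c))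
    (ι : ∀ x : g, motive (UniversalEnvelopingAlgebra.ι ℂ x))
    (mul : ∀ a b, motive a → motive b → motive (a * b))
    (add : ∀ a b, motive a → motive b → motive (a + b))
    (a : UniversalEnvelopingAlgebra ℂ g) : motive a := by
  let S : Subalgebra ℂ (UniversalEnvelopingAlgebra ℂ g) :=
    { carrier := {a | motive a}
      mul_mem' := fun {a b} ha hb => mul a b ha hb
      add_mem' := fun {a b} ha hb => add a b ha hb
      algebraMap_mem' := algebraMap }
  let l : g →ₗ⁅ℂ⁆ S :=
    { toFun := fun x => ⟨UniversalEnvelopingAlgebra.ι ℂ x, ι x⟩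
      map_add' := fun x y => Subtype.ext (map_add _ x y)
      map_smul' := fun c x => Subtype.ext (map_smul _ c x)
      map_lie' := fun {x y} => Subtype.ext (by
        simp [Ring.lie_def]) }
  have h : S.val.comp (UniversalEnvelopingAlgebra.lift ℂ l) =
      AlgHom.id ℂ (UniversalEnvelopingAlgebra ℂ g) := by
    apply UniversalEnvelopingAlgebra.hom_ext
    ext x
    simp [l]
  have h2 := congrArg (fun F => F a) h
  have h3 : S.val (UniversalEnvelopingAlgebra.lift ℂ l a) = a := h2
  rw [← h3]
  exact (UniversalEnvelopingAlgebra.lift ℂ l a).2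

end EnvelopingInduction

theorem UniversalEnvelopingAlgebra.adjoin_range_ι (g : Type*) [LieRing g] [LieAlgebra ℂ g] :
    Algebra.adjoin ℂ (Set.range (UniversalEnvelopingAlgebra.ι ℂ (L := g))) = ⊤ := by
  rw [eq_top_iff]
  rintro a -
  induction a using UniversalEnvelopingAlgebra.induction_on_generators with
  | algebraMap c => exact Subalgebra.algebraMap_mem _ c
  | ι x => exact Algebra.subset_adjoin ⟨x, rfl⟩
  | mul a b ha hb => exact mul_mem ha hb
  | add a b ha hb => exact add_mem ha hb

/-! ### Simplicity of cyclic quotients of `R ⊗ ℂ` -/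

section CyclicQuotient

theorem smul_mul_smul_of_commutator {R M : Type*} [Ring R] [AddCommGroup M] [Module R M]
    {y z w a a' b : R} {v : M} (h : z * y = y * z + w) (h1 : z • a • v = a' • v)
    (h2 : w • a • v = b • v) : z • (y * a) • v = (y * a' + b) • v := by
  rw [mul_smul, smul_smul, h, add_smul, mul_smul, h1, h2, add_smul, mul_smul]

variable {R P : Type*} [Ring R] [Algebra ℂ R] [AddCommGroup P] [Module ℂ P]

theorem tmul_eq_smul_one_tmul_one {R : Type*} [Ring R] [Algebra ℂ R] (a : R) (c : ℂ) :
    a ⊗ₜ[ℂ] c = (c • a) • (1 : R) ⊗ₜ[ℂ] (1 : ℂ) := by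
  rw [TensorProduct.smul_tmul', smul_eq_mul, mul_one, TensorProduct.smul_tmul, smul_eq_mul, mul_one]

/-- The map `a ⊗ c ↦ c a e` from `R ⊗ ℂ` to a representation `P`, semilinear over the
image of `R` in the endomorphisms of `P`. -/
noncomputable def tensorAction (E : R →ₐ[ℂ] Module.End ℂ P) (e : P) :
    (R ⊗[ℂ] ℂ) →ₛₗ[E.rangeRestrict.toRingHom] P where
  toFun := TensorProduct.lift
    ((LinearMap.lcomp ℂ P (LinearMap.toSpanSingleton ℂ P e)) ∘ₗ E.toLinearMap)
  map_add' := map_add _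
  map_smul' u t := by
    induction t using TensorProduct.induction_on with
    | zero => simp
    | add x y hx hy => rw [smul_add, map_add, hx, hy, map_add, smul_add]
    | tmul a c =>
      rw [TensorProduct.smul_tmul']
      simp only [smul_eq_mul, TensorProduct.lift.tmul, LinearMap.comp_apply,
        AlgHom.toLinearMap_apply, LinearMap.lcomp_apply, LinearMap.toSpanSingleton_apply, map_mul]
      rfl

theorem tensorAction_tmul (E : R →ₐ[ℂ] Module.End ℂ P) (e : P) (a : R) (c : ℂ) :
    tensorAction E e (a ⊗ₜ c) = E a (c • e) := rfl

theorem exists_smul_mkQ_one_tmul_one (N : Submodule R (R ⊗[ℂ] ℂ)) (m : (R ⊗[ℂ] ℂ) ⧸ N) :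
    ∃ u : R, m = u • N.mkQ (1 ⊗ₜ 1) := by
  obtain ⟨t, rfl⟩ := N.mkQ_surjective m
  induction t using TensorProduct.induction_on with
  | zero => exact ⟨0, by simp⟩
  | add x y hx hy =>
    obtain ⟨u, hu⟩ := hx
    obtain ⟨v, hv⟩ := hy
    exact ⟨u + v, by rw [map_add, hu, hv, add_smul]⟩
  | tmul a c => exact ⟨c • a, by rw [tmul_eq_smul_one_tmul_one, map_smul]⟩

/-- `P` carries no `R`-module instance, so the image of `R` in the endomorphisms takes the place of
`R`. Stability under generators of `R` already gives stability under this image. -/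
theorem isSimpleModule_range_iff (E : R →ₐ[ℂ] Module.End ℂ P) [Nontrivial P] {s : Set R}
    (hs : Algebra.adjoin ℂ s = ⊤) :
    IsSimpleModule E.range P ↔
      ∀ K : Submodule ℂ P, (∀ u ∈ s, ∀ f ∈ K, E u f ∈ K) → K = ⊥ ∨ K = ⊤ := by
  rw [isSimpleModule_iff]
  constructor
  · intro h K hK
    have hU (u : R) : ∀ f ∈ K, E u f ∈ K := by
      have hu : u ∈ Algebra.adjoin ℂ s := hs ▸ Algebra.mem_top
      induction hu using Algebra.adjoin_induction with
      | mem x hx => exact hK x hx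
      | algebraMap c =>
        intro f hf
        rw [AlgHom.commutes, Module.algebraMap_end_apply]
        exact K.smul_mem c hf
      | mul a b _ _ ha hb => intro f hf; rw [map_mul]; exact ha _ (hb f hf)
      | add a b _ _ ha hb => intro f hf; rw [map_add]; exact K.add_mem (ha f hf) (hb f hf)
    let K' : Submodule E.range P :=
      { K with
        smul_mem' := by
          rintro ⟨_, u, rfl⟩ f hf
          exact hU u f hf }
    have hmem (f) : f ∈ K' ↔ f ∈ K := Iff.rfl
    rcases h.eq_bot_or_eq_top K' with h | h
    · left
      ext f
      rw [← hmem, h, Submodule.mem_bot, Submodule.mem_bot]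
    · right
      ext f
      rw [← hmem, h]
      simp
  · intro h
    refine { exists_pair_ne := ⟨⊥, ⊤, bot_ne_top⟩, eq_bot_or_eq_top := fun N => ?_ }
    have hN := h (N.restrictScalars ℂ) fun u _ f hf => N.smul_mem ⟨_, u, rfl⟩ hf
    simpa using hN

/-- If a linear section `F` of the action on `e ∈ P` intertwines the generators of `R` with their
action on a cyclic quotient of `R ⊗ ℂ`, then this quotient is isomorphic to `P`. -/
theorem isSimpleModule_quotient_iff (E : R →ₐ[ℂ] Module.End ℂ P) [Nontrivial P] {s : Set R}
    (hs : Algebra.adjoin ℂ s = ⊤) (N : Submodule R (R ⊗[ℂ] ℂ)) (e : P)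
    (hN : ∀ t ∈ N, tensorAction E e t = 0) (F : P →ₗ[ℂ] R) (hF : ∀ f, E (F f) e = f)
    (hF1 : F e = 1)
    (hFs : ∀ u ∈ s, ∀ f, u • F f • N.mkQ (1 ⊗ₜ 1) = F (E u f) • N.mkQ (1 ⊗ₜ 1)) :
    IsSimpleModule R ((R ⊗[ℂ] ℂ) ⧸ N) ↔
      ∀ K : Submodule ℂ P, (∀ u ∈ s, ∀ f ∈ K, E u f ∈ K) → K = ⊥ ∨ K = ⊤ := by
  set v := N.mkQ (1 ⊗ₜ 1) with hv
  have h1 (u : R) : ∀ f, u • F f • v = F (E u f) • v := by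
    have hu : u ∈ Algebra.adjoin ℂ s := hs ▸ Algebra.mem_top
    induction hu using Algebra.adjoin_induction with
    | mem x hx => exact hFs x hx
    | algebraMap c =>
      intro f
      rw [smul_smul, ← Algebra.smul_def, AlgHom.commutes, Module.algebraMap_end_apply, map_smul F]
    | mul a b _ _ ha hb => intro f; rw [mul_smul, hb, ha, map_mul]; rfl
    | add a b _ _ ha hb =>
      intro f; rw [add_smul, ha, hb, ← add_smul, ← map_add, map_add E, LinearMap.add_apply]
  let l : (R ⊗[ℂ] ℂ) ⧸ N →ₛₗ[E.rangeRestrict.toRingHom] P := N.liftQ (tensorAction E e) hN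
  have hl (u : R) : l (u • v) = E u e := by
    rw [hv, ← map_smul, TensorProduct.smul_tmul', smul_eq_mul, mul_one]
    exact (tensorAction_tmul E e u 1).trans (by rw [one_smul])
  have h2 (f : P) : l (F f • v) = f := by rw [hl, hF]
  have h3 (m : (R ⊗[ℂ] ℂ) ⧸ N) : ∃ f, m = F f • v := by
    obtain ⟨u, rfl⟩ := exists_smul_mkQ_one_tmul_one N m
    exact ⟨E u e, by rw [← h1, hF1, one_smul]⟩
  -- Every element of the quotient is some `F f • v`, and `l` recovers `f` from it; this takes the
  -- place of PBW.
  have hbij : Function.Bijective l := by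
    refine ⟨fun m m' h => ?_, fun f => ⟨_, h2 f⟩⟩
    obtain ⟨f, rfl⟩ := h3 m
    obtain ⟨f', rfl⟩ := h3 m'
    rw [h2, h2] at h
    rw [h]
  have : RingHomSurjective E.rangeRestrict.toRingHom := ⟨E.rangeRestrict_surjective⟩
  exact (LinearMap.isSimpleModule_iff_of_bijective l hbij).trans (isSimpleModule_range_iff E hs)

end CyclicQuotient

/-! ### Identification of the Verma module with polynomials -/

section PolynomialModel

open MvPolynomial

variable {p q : ℕ}

/-- The action of the enveloping algebra on polynomials. -/
noncomputable def envRep (p q : ℕ) (lam : ℂ) : UniversalEnvelopingAlgebra ℂ (soLie p q ℂ) →ₐ[ℂ]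
    Module.End ℂ (MvPolynomial (Fin (p + q - 2)) ℂ) :=
  UniversalEnvelopingAlgebra.lift ℂ (confRep p q lam)

theorem envRep_ι (lam : ℂ) (Z : soLie p q ℂ) :
    envRep p q lam (UniversalEnvelopingAlgebra.ι ℂ Z) = confOp lam Z.1 := by
  rw [envRep, UniversalEnvelopingAlgebra.lift_ι_apply, confRep_apply]

/-- The parabolic subalgebra acts on constants by the character. -/
theorem envRep_envelopingIncl_C (lam : ℂ) (a : UniversalEnvelopingAlgebra ℂ (confParabolic p q))
    (c : ℂ) :
    envRep p q lam (envelopingIncl (confParabolic p q) a) (C c) =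
      C (UniversalEnvelopingAlgebra.lift ℂ (confCharacter p q lam) a c) := by
  induction a using UniversalEnvelopingAlgebra.induction_on_generators generalizing c with
  | algebraMap b =>
    simp only [AlgHom.commutes, Module.algebraMap_end_apply, smul_eq_C_mul, smul_eq_mul, C_mul]
  | ι Z =>
    have h : envelopingIncl (confParabolic p q) (UniversalEnvelopingAlgebra.ι ℂ Z) =
        UniversalEnvelopingAlgebra.ι ℂ Z.1 := by
      rw [envelopingIncl, UniversalEnvelopingAlgebra.lift_ι_apply]; rfl
    rw [h, envRep_ι, confOp_C_eq_add, UniversalEnvelopingAlgebra.lift_ι_apply]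
    have hz (i) : Z.1.1 (idxMid i) idxZero = 0 := Z.2 _ (by simp)
    simp [hz, confCharacter, mul_comm]
  | mul a b ha hb => simp [ha, hb]
  | add a b ha hb => simp [ha, hb]

/-- The canonical generator of the scalar generalized Verma module. -/
noncomputable def vermaVector (p q : ℕ) (lam : ℂ) : ScalarVermaModule p q lam :=
  (balancedRelations (confParabolic p q) (confCharacter p q lam)).mkQ (1 ⊗ₜ 1)

theorem lie_loweringElt (v w : Fin (p + q - 2) → ℂ) : ⁅loweringElt v, loweringElt w⁆ = 0 := by
  apply Subtype.ext
  ext (⟨⟨⟩⟩ | i | ⟨⟨⟩⟩) (⟨⟨⟩⟩ | j | ⟨⟨⟩⟩) <;> rw [soLie_coe_lie] <;>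
    simp [loweringElt, loweringMatrix]
  rw [neg_add_eq_zero]
  exact Finset.sum_congr rfl fun _ _ => by ring

theorem loweringElt_eq_sum (w : Fin (p + q - 2) → ℂ) :
    loweringElt w = ∑ i, w i • loweringElt (Pi.single i 1) := by
  apply Subtype.ext
  rw [AddSubmonoidClass.coe_finsetSum]
  ext (⟨⟨⟩⟩ | i | ⟨⟨⟩⟩) (⟨⟨⟩⟩ | j | ⟨⟨⟩⟩) <;> rw [Matrix.sum_apply] <;>
    simp [loweringElt, loweringMatrix, Pi.single_apply, mul_comm]

/-- The basis of the opposite nilradical commutes, so polynomials in it can be evaluated in the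
enveloping algebra. -/
theorem exists_polynomialToEnveloping (p q : ℕ) :
    ∃ F : MvPolynomial (Fin (p + q - 2)) ℂ →ₐ[ℂ] UniversalEnvelopingAlgebra ℂ (soLie p q ℂ),
      ∀ i, F (X i) = UniversalEnvelopingAlgebra.ι ℂ (loweringElt (Pi.single i 1)) := by
  let y (i : Fin (p + q - 2)) : UniversalEnvelopingAlgebra ℂ (soLie p q ℂ) :=
    UniversalEnvelopingAlgebra.ι ℂ (loweringElt (Pi.single i 1))
  have hc : ∀ a ∈ Set.range y, ∀ b ∈ Set.range y, a * b = b * a := by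
    rintro _ ⟨i, rfl⟩ _ ⟨j, rfl⟩
    rw [← sub_eq_zero, ← Ring.lie_def, ← LieHom.map_lie, lie_loweringElt, map_zero]
  have := Algebra.isMulCommutative_adjoin ℂ hc
  -- `aeval` needs a commutative target, so it lands in the subalgebra generated by the commuting `y
  -- i`.
  let : CommRing (Algebra.adjoin ℂ (Set.range y)) :=
    { (Algebra.adjoin ℂ (Set.range y)).toRing with mul_comm := mul_comm' }
  refine ⟨(Algebra.adjoin ℂ (Set.range y)).val.comp
    (aeval fun i => (⟨y i, Algebra.subset_adjoin ⟨i, rfl⟩⟩ : Algebra.adjoin ℂ (Set.range y))),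
    fun i => ?_⟩
  simp [y]

/-- The homomorphism from polynomials to the enveloping algebra that sends the variables to the
basis of the opposite nilradical. -/
noncomputable def polynomialToEnveloping (p q : ℕ) :
    MvPolynomial (Fin (p + q - 2)) ℂ →ₐ[ℂ] UniversalEnvelopingAlgebra ℂ (soLie p q ℂ) :=
  (exists_polynomialToEnveloping p q).choose

theorem polynomialToEnveloping_X (i : Fin (p + q - 2)) : polynomialToEnveloping p q (X i) =
    UniversalEnvelopingAlgebra.ι ℂ (loweringElt (Pi.single i 1)) :=
  (exists_polynomialToEnveloping p q).choose_spec i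

theorem envRep_polynomialToEnveloping (lam : ℂ) (f g : MvPolynomial (Fin (p + q - 2)) ℂ) :
    envRep p q lam (polynomialToEnveloping p q f) g = f * g := by
  have h : (envRep p q lam).comp (polynomialToEnveloping p q) =
      Algebra.lmul ℂ (MvPolynomial (Fin (p + q - 2)) ℂ) := by
    apply MvPolynomial.algHom_ext
    intro i
    refine LinearMap.ext fun g => ?_
    rw [AlgHom.comp_apply, polynomialToEnveloping_X, envRep_ι, confOp_loweringElt]
    simp [Pi.single_apply]
  exact congrArg (fun F => F f g) h

theorem ι_smul_vermaVector_of_mem (lam : ℂ) (Z : soLie p q ℂ) (hZ : Z ∈ confParabolic p q) :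
    UniversalEnvelopingAlgebra.ι ℂ Z • vermaVector p q lam =
      algebraMap ℂ (UniversalEnvelopingAlgebra ℂ (soLie p q ℂ)) (lam * Z.1 idxZero idxZero) •
        vermaVector p q lam := by
  rw [vermaVector, ← map_smul, ← map_smul, ← sub_eq_zero, ← map_sub, Submodule.mkQ_apply,
    Submodule.Quotient.mk_eq_zero]
  apply Submodule.subset_span
  refine ⟨1, UniversalEnvelopingAlgebra.ι ℂ ⟨Z, hZ⟩, 1, ?_⟩
  have h : envelopingIncl (confParabolic p q) (UniversalEnvelopingAlgebra.ι ℂ ⟨Z, hZ⟩) =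
      UniversalEnvelopingAlgebra.ι ℂ Z := by
    rw [envelopingIncl, UniversalEnvelopingAlgebra.lift_ι_apply]; rfl
  have h1 : UniversalEnvelopingAlgebra.lift ℂ (confCharacter p q lam)
      (UniversalEnvelopingAlgebra.ι ℂ ⟨Z, hZ⟩) 1 = lam * Z.1 idxZero idxZero := by
    rw [UniversalEnvelopingAlgebra.lift_ι_apply]
    exact mul_one _
  rw [h, h1, tmul_eq_smul_one_tmul_one (1 * _) (1 : ℂ), tmul_eq_smul_one_tmul_one 1 (lam * _),
    one_smul, one_mul, Algebra.algebraMap_eq_smul_one]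

/-- The decomposition of `g` into the opposite nilradical and the parabolic subalgebra. -/
theorem sub_loweringElt_mem (Z : soLie p q ℂ) :
    Z - loweringElt (fun i => Z.1 (idxMid i) idxZero) ∈ confParabolic p q := by
  rintro (⟨⟨⟩⟩ | i | ⟨⟨⟩⟩) hi
  · exact absurd rfl hi
  · change Z.1 _ _ - _ = 0
    simp [loweringElt, loweringMatrix]
  · change Z.1 _ _ - _ = 0
    rw [soLie_last_zero]
    simp [loweringElt, loweringMatrix]

/-- The recursion of `confOp_X_mul` also holds inside the Verma module, and on the generator the
parabolic part of `Z` acts by the character. -/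
theorem ι_smul_polynomial_smul (lam : ℂ) (Z : soLie p q ℂ)
    (f : MvPolynomial (Fin (p + q - 2)) ℂ) :
    UniversalEnvelopingAlgebra.ι ℂ Z • polynomialToEnveloping p q f • vermaVector p q lam =
      polynomialToEnveloping p q (confOp lam Z.1 f) • vermaVector p q lam := by
  induction f using MvPolynomial.induction_on generalizing Z with
  | C c =>
    have hC : polynomialToEnveloping p q (C c) = algebraMap ℂ _ c :=
      (polynomialToEnveloping p q).commutes c
    have h1 := ι_smul_vermaVector_of_mem lam _ (sub_loweringElt_mem Z)
    have h2 : (Z - loweringElt (fun i => Z.1 (idxMid i) idxZero)).1 idxZero idxZero =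
        Z.1 idxZero idxZero := by
      change Z.1 _ _ - _ = _
      simp [loweringElt, loweringMatrix]
    have h3 : UniversalEnvelopingAlgebra.ι ℂ (loweringElt (fun i => Z.1 (idxMid i) idxZero)) =
        polynomialToEnveloping p q (∑ i, C (Z.1 (idxMid i) idxZero) * X i) := by
      rw [loweringElt_eq_sum]
      simp only [← smul_eq_C_mul, map_sum, map_smul, polynomialToEnveloping_X]
    have h4 : UniversalEnvelopingAlgebra.ι ℂ Z • vermaVector p q lam =
        polynomialToEnveloping p q ((∑ i, C (Z.1 (idxMid i) idxZero) * X i) +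
          C (Z.1 idxZero idxZero) * C lam) • vermaVector p q lam := by
      have h5 : polynomialToEnveloping p q (C (Z.1 idxZero idxZero) * C lam) =
          algebraMap ℂ _ (lam * Z.1 idxZero idxZero) := by
        rw [← C_mul, mul_comm]
        exact (polynomialToEnveloping p q).commutes _
      rw [h2, map_sub, sub_smul, sub_eq_iff_eq_add, h3] at h1
      rw [h1, map_add, h5, add_smul, add_comm]
    rw [confOp_C_eq_add, ← add_mul, mul_comm _ (C c), map_mul, hC, smul_smul, ← Algebra.commutes,
      mul_smul, h4, mul_smul]
  | add f g hf hg => simp only [map_add, add_smul, smul_add, hf, hg]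
  | mul_X f i hf =>
    have h : UniversalEnvelopingAlgebra.ι ℂ Z *
        UniversalEnvelopingAlgebra.ι ℂ (loweringElt (Pi.single i 1)) =
        UniversalEnvelopingAlgebra.ι ℂ (loweringElt (Pi.single i 1)) *
          UniversalEnvelopingAlgebra.ι ℂ Z +
        UniversalEnvelopingAlgebra.ι ℂ ⁅Z, loweringElt (Pi.single i 1)⁆ := by
      rw [LieHom.map_lie, Ring.lie_def]
      abel
    have e (g : MvPolynomial (Fin (p + q - 2)) ℂ) : polynomialToEnveloping p q (X i * g) =
        UniversalEnvelopingAlgebra.ι ℂ (loweringElt (Pi.single i 1)) *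
          polynomialToEnveloping p q g := by
      rw [map_mul, polynomialToEnveloping_X]
    rw [mul_comm f, confOp_X_mul, e, map_add, e]
    exact smul_mul_smul_of_commutator h (hf Z) (hf _)

theorem tensorAction_eq_zero_of_mem (lam : ℂ)
    (t : UniversalEnvelopingAlgebra ℂ (soLie p q ℂ) ⊗[ℂ] ℂ)
    (ht : t ∈ balancedRelations (confParabolic p q) (confCharacter p q lam)) :
    tensorAction (envRep p q lam) 1 t = 0 := by
  induction ht using Submodule.span_induction with
  | mem x hx =>
    obtain ⟨u, a, v, rfl⟩ := hx
    have h (c : ℂ) : c • (1 : MvPolynomial (Fin (p + q - 2)) ℂ) = C c := by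
      rw [smul_eq_C_mul, mul_one]
    rw [map_sub, tensorAction_tmul, tensorAction_tmul, map_mul, Module.End.mul_apply, h, h,
      envRep_envelopingIncl_C, sub_self]
  | zero => exact map_zero _
  | add x y _ _ hx hy => rw [map_add, hx, hy, add_zero]
  | smul a x _ hx => rw [LinearMap.map_smulₛₗ, hx, smul_zero]

/-- The scalar generalized Verma module is simple if and only if the polynomial model has no
nontrivial invariant subspace. -/
theorem isSimpleModule_scalarVermaModule_iff (p q : ℕ) (lam : ℂ) :
    IsSimpleModule (UniversalEnvelopingAlgebra ℂ (soLie p q ℂ)) (ScalarVermaModule p q lam) ↔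
      ∀ K : Submodule ℂ (MvPolynomial (Fin (p + q - 2)) ℂ),
        (∀ (Z : soLie p q ℂ), ∀ f ∈ K, confOp lam Z.1 f ∈ K) → K = ⊥ ∨ K = ⊤ := by
  refine (isSimpleModule_quotient_iff (envRep p q lam)
    (UniversalEnvelopingAlgebra.adjoin_range_ι (soLie p q ℂ))
    (balancedRelations (confParabolic p q) (confCharacter p q lam)) 1
    (tensorAction_eq_zero_of_mem lam) (polynomialToEnveloping p q).toLinearMap
    (fun f => (envRep_polynomialToEnveloping lam f 1).trans (mul_one f))
    (map_one (polynomialToEnveloping p q)) ?_).trans ?_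
  · rintro _ ⟨Z, rfl⟩ f
    rw [envRep_ι]
    exact ι_smul_polynomial_smul lam Z f
  · simp only [Set.forall_mem_range, envRep_ι]

end PolynomialModel

/-! ### Singular vectors in the polynomial model -/

section Singular

open MvPolynomial

variable {σ : Type*}

theorem MvPolynomial.IsHomogeneous.degree_eq {f : MvPolynomial σ ℂ} {m : ℕ}
    (hf : f.IsHomogeneous m) {α : σ →₀ ℕ} (hα : coeff α f ≠ 0) : α.degree = m :=
  (DFunLike.congr_fun Finsupp.degree_eq_weight_one α).trans (hf hα)

/-- Comparing coefficients in the rotation equation ties the coefficient at `α` to one whose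
exponent of `ξ_i` is smaller by two. At exponent one the right side has no such term, so odd
exponents die by descent. -/
theorem coeff_eq_zero_of_odd (ε : σ → ℂ) {f : MvPolynomial σ ℂ} {i j : σ} (hij : i ≠ j)
    (hj : ε j ≠ 0)
    (h : ε j • (X j * pderiv i f) = ε i • (X i * pderiv j f)) (k : ℕ) :
    ∀ α : σ →₀ ℕ, α i = 2 * k + 1 → coeff α f = 0 := by
  classical
  induction k with
  | zero =>
    intro α hα
    obtain ⟨γ, rfl⟩ : ∃ γ, α = γ + Finsupp.single i 1 :=
      ⟨_, (tsub_add_cancel_of_le (Finsupp.single_le_iff.2 (by omega))).symm⟩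
    have hγ : γ i = 0 := by simpa using hα
    have h1 := congrArg (coeff (Finsupp.single j 1 + γ)) h
    rw [coeff_smul, coeff_smul, coeff_X_mul, coeff_pderiv, coeff_X_mul', if_neg (by
      simp [hγ, hij]), hγ] at h1
    simpa [hj] using h1
  | succ k ih =>
    intro α hα
    obtain ⟨γ, rfl⟩ : ∃ γ, α = γ + Finsupp.single i 1 :=
      ⟨_, (tsub_add_cancel_of_le (Finsupp.single_le_iff.2 (by omega))).symm⟩
    have hγ : γ i = 2 * k + 2 := by
      simp at hα
      omega
    have h1 := congrArg (coeff (Finsupp.single j 1 + γ)) h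
    have hz : coeff (Finsupp.single j 1 + γ - Finsupp.single i 1 + Finsupp.single j 1) f = 0 :=
      ih _ (by simp [hγ, hij])
    rw [coeff_smul, coeff_smul, coeff_X_mul, coeff_pderiv, coeff_X_mul', coeff_pderiv, hz, zero_mul,
      ite_self, smul_zero] at h1
    have h2 : (γ i : ℂ) + 1 ≠ 0 := by exact_mod_cast (γ i).succ_ne_zero
    simpa [hj, h2] using h1

variable [Fintype σ]

theorem coeff_eulerOp (f : MvPolynomial σ ℂ) (α : σ →₀ ℕ) :
    coeff α (eulerOp σ f) = (α.degree : ℂ) * coeff α f := by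
  classical
  have h (i : σ) : coeff α (X i * pderiv i f) = (α i : ℂ) * coeff α f := by
    rw [coeff_X_mul', coeff_pderiv]
    split_ifs with hi
    · have h1 : 1 ≤ α i := Nat.one_le_iff_ne_zero.2 (Finsupp.mem_support_iff.1 hi)
      have h2 : α - Finsupp.single i 1 + Finsupp.single i 1 = α :=
        tsub_add_cancel_of_le (Finsupp.single_le_iff.2 h1)
      rw [h2, Finsupp.tsub_apply, Finsupp.single_eq_same, Nat.cast_sub h1]
      push_cast
      ring
    · simp [Finsupp.notMem_support_iff.1 hi]
  rw [eulerOp_apply, coeff_sum, Finset.sum_congr rfl fun i _ => h i, ← Finset.sum_mul,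
    Finsupp.degree_eq_sum]
  push_cast
  rfl

theorem MvPolynomial.IsHomogeneous.eulerOp_eq {f : MvPolynomial σ ℂ} {m : ℕ}
    (hf : f.IsHomogeneous m) : eulerOp σ f = (m : ℂ) • f := by
  ext α
  rw [coeff_eulerOp, coeff_smul, smul_eq_mul]
  by_cases h : coeff α f = 0
  · simp [h]
  · rw [hf.degree_eq h]

theorem isHomogeneous_of_eulerOp_eq {f : MvPolynomial σ ℂ} {m : ℕ}
    (hf : eulerOp σ f = (m : ℂ) • f) : f.IsHomogeneous m := by
  intro α hα
  have h := congrArg (coeff α) hf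
  rw [coeff_eulerOp, coeff_smul, smul_eq_mul] at h
  have h2 := mul_right_cancel₀ hα h
  exact (DFunLike.congr_fun Finsupp.degree_eq_weight_one α).symm.trans (by exact_mod_cast h2)

theorem totalDegree_smul_sub_eulerOp_lt {f : MvPolynomial σ ℂ} (h : 0 < f.totalDegree) :
    ((f.totalDegree : ℂ) • f - eulerOp σ f).totalDegree < f.totalDegree := by
  refine (Finset.sup_lt_iff h).2 fun α hα => ?_
  rw [mem_support_iff, coeff_sub, coeff_eulerOp, coeff_smul, smul_eq_mul, ← sub_mul] at hα
  refine lt_of_le_of_ne (le_totalDegree (mem_support_iff.2 (right_ne_zero_of_mul hα))) fun h4 => ?_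
  have h5 : α.degree = f.totalDegree := h4
  exact left_ne_zero_of_mul hα (by rw [h5, sub_self])

variable (ε : σ → ℂ) (lam : ℂ)

theorem signedLaplacian_eq_zero_of_isHomogeneous_one {f : MvPolynomial σ ℂ}
    (hf : f.IsHomogeneous 1) : signedLaplacian ε f = 0 := by
  rw [signedLaplacian_apply]
  refine Finset.sum_eq_zero fun i _ => ?_
  have h : (pderiv i f).IsHomogeneous 0 := hf.pderiv
  rw [← totalDegree_zero_iff_isHomogeneous, totalDegree_eq_zero_iff_eq_C] at h
  rw [h, pderiv_C, smul_zero]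

theorem MvPolynomial.IsHomogeneous.signedLaplacian {f : MvPolynomial σ ℂ} {m : ℕ}
    (hf : f.IsHomogeneous m) : (signedLaplacian ε f).IsHomogeneous (m - 1 - 1) := by
  rw [signedLaplacian_apply]
  refine IsHomogeneous.sum _ _ _ fun i _ => ?_
  rw [smul_eq_C_mul]
  exact hf.pderiv.pderiv.C_mul _

theorem besselOp_apply_of_isHomogeneous {f : MvPolynomial σ ℂ} {m : ℕ}
    (hf : f.IsHomogeneous (m + 1)) (j : σ) :
    besselOp ε lam j f = (lam - m) • pderiv j f + (ε j / 2) • (X j * signedLaplacian ε f) := by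
  have h : (pderiv j f).IsHomogeneous m := hf.pderiv
  rw [besselOp_apply, h.eulerOp_eq, sub_smul]

theorem MvPolynomial.IsHomogeneous.besselOp {f : MvPolynomial σ ℂ} {m : ℕ}
    (hf : f.IsHomogeneous (m + 1)) (j : σ) : (besselOp ε lam j f).IsHomogeneous m := by
  have h : (pderiv j f).IsHomogeneous m := hf.pderiv
  rw [besselOp_apply_of_isHomogeneous ε lam hf, smul_eq_C_mul, smul_eq_C_mul]
  refine (h.C_mul _).add ?_
  cases m with
  | zero =>
    -- With truncated subtraction `X j * Δ f` would get degree one here; it is zero instead.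
    rw [signedLaplacian_eq_zero_of_isHomogeneous_one ε hf, mul_zero, mul_zero]
    exact isHomogeneous_zero _ _ _
  | succ k =>
    have h2 : (_root_.signedLaplacian ε f).IsHomogeneous k := hf.signedLaplacian ε
    have h3 := (isHomogeneous_X ℂ j).mul h2
    rw [add_comm] at h3
    exact h3.C_mul _

theorem even_of_coeff_ne_zero {f : MvPolynomial σ ℂ} {m : ℕ} (hf : f.IsHomogeneous m)
    (hf0 : f ≠ 0) (hσ : Nontrivial σ) (hε : ∀ i, ε i ≠ 0)
    (h : ∀ i j, ε j • (X j * pderiv i f) = ε i • (X i * pderiv j f)) : Even m := by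
  obtain ⟨α, hα⟩ := ne_zero_iff.1 hf0
  rw [← hf.degree_eq hα, Finsupp.degree_eq_sum]
  refine Finset.even_sum _ fun i _ => ?_
  by_contra hi
  obtain ⟨k, hk⟩ := Nat.not_even_iff_odd.1 hi
  obtain ⟨j, hj⟩ := exists_ne i
  exact hα (coeff_eq_zero_of_odd ε hj.symm (hε j) (h i j) k α hk)

/-- A homogeneous polynomial of positive degree in the kernel of the Bessel operators exists only
for special parameters. -/
theorem parameter_of_besselOp_eq_zero {f : MvPolynomial σ ℂ} {m : ℕ} (hε : ∀ i, ε i * ε i = 1)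
    (hf : f.IsHomogeneous (m + 1)) (hf0 : f ≠ 0) (h : ∀ j, besselOp ε lam j f = 0) :
    lam = m ∨ (2 * lam = (m + 1 : ℕ) - (Fintype.card σ : ℂ) ∧ (Nontrivial σ → Even (m + 1))) := by
  have hε0 (i) : ε i ≠ 0 := left_ne_zero_of_mul (hε i ▸ one_ne_zero)
  simp only [besselOp_apply_of_isHomogeneous ε lam hf] at h
  by_cases hl : lam - m = 0
  · exact Or.inl (sub_eq_zero.1 hl)
  right
  -- Otherwise all partial derivatives vanish, and Euler's identity gives `f = 0`.
  have hL : signedLaplacian ε f ≠ 0 := by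
    intro hL
    apply hf0
    have h1 (j) : pderiv j f = 0 := by
      have := h j
      rw [hL, mul_zero, smul_zero, add_zero] at this
      exact (smul_eq_zero.1 this).resolve_left hl
    have h2 := hf.eulerOp_eq
    rw [eulerOp_apply] at h2
    simp only [h1, mul_zero, Finset.sum_const_zero] at h2
    exact (smul_eq_zero.1 h2.symm).resolve_left (Nat.cast_ne_zero.2 m.succ_ne_zero)
  obtain ⟨k, rfl⟩ : ∃ k, m = k + 1 := by
    cases m with
    | zero => exact absurd (signedLaplacian_eq_zero_of_isHomogeneous_one ε hf) hL
    | succ k => exact ⟨k, rfl⟩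
  refine ⟨?_, fun hσ => ?_⟩
  -- Applying `∑ ε_j ∂_j` to the equations gives a scalar multiple of `Δ f`, whose coefficient must
  -- vanish.
  · have h1 : (_root_.signedLaplacian ε f).IsHomogeneous k := hf.signedLaplacian ε
    have h2 : ∑ j, ε j • pderiv j ((lam - (k + 1 : ℕ)) • pderiv j f +
        (ε j / 2) • (X j * signedLaplacian ε f)) = 0 :=
      Finset.sum_eq_zero fun j _ => by rw [h j, map_zero, smul_zero]
    have h3 (j) : ε j • pderiv j ((lam - (k + 1 : ℕ)) • pderiv j f +
        (ε j / 2) • (X j * signedLaplacian ε f)) =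
        (lam - (k + 1 : ℕ)) • (ε j • pderiv j (pderiv j f)) + (1 / 2 : ℂ) • signedLaplacian ε f +
          (1 / 2 : ℂ) • (X j * pderiv j (signedLaplacian ε f)) := by
      have h4 : ε j * (ε j / 2) = 1 / 2 := by rw [← mul_div_assoc, hε]
      rw [map_add, Derivation.map_smul, Derivation.map_smul, pderiv_mul, pderiv_X_self, one_mul,
        smul_add, smul_comm, smul_smul (ε j), h4, smul_add, add_assoc]
    rw [Finset.sum_congr rfl fun j _ => h3 j, Finset.sum_add_distrib, Finset.sum_add_distrib,
      ← Finset.smul_sum, ← Finset.smul_sum (r := (1 / 2 : ℂ)) (f := fun x => X x * _),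
      ← eulerOp_apply, h1.eulerOp_eq,
      ← signedLaplacian_apply, Finset.sum_const, Finset.card_univ, ← Nat.cast_smul_eq_nsmul ℂ,
      smul_smul, smul_smul, ← add_smul, ← add_smul] at h2
    have h5 := (smul_eq_zero.1 h2).resolve_right hL
    push_cast at h5 ⊢
    linear_combination 2 * h5
  -- Eliminating `Δ f` between the equations for `i` and `j` gives the rotation equation.
  · refine even_of_coeff_ne_zero ε hf hf0 hσ hε0 fun i j => ?_
    have h1 (j) : (lam - (k + 1 : ℕ)) • pderiv j f = -((ε j / 2) • (X j * signedLaplacian ε f)) :=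
      eq_neg_of_add_eq_zero_left (h j)
    apply smul_right_injective _ hl
    simp only
    rw [smul_comm _ (ε j), ← mul_smul_comm (lam - _), h1, smul_comm _ (ε i),
      ← mul_smul_comm (lam - _), h1]
    simp only [smul_eq_C_mul, div_eq_mul_inv, C_mul]
    ring

end Singular

/-! ### Invariant subspaces of the polynomial model -/

section InvariantSubspaces

open MvPolynomial

variable {p q : ℕ}

/-- The matrix with row `e_j` beside the entry `(0, 0)` in the nilradical. -/
def raisingMatrix (j : Fin (p + q - 2)) : Matrix (ConfIdx p q) (ConfIdx p q) ℂ :=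
  Matrix.of fun a b =>
    match a, b with
    | Sum.inl _, Sum.inr (Sum.inl i) => if j = i then 1 else 0
    | Sum.inr (Sum.inl i), Sum.inr (Sum.inr _) => if j = i then -confSign p q ℂ i else 0
    | _, _ => 0

theorem raisingMatrix_mem (j : Fin (p + q - 2)) : raisingMatrix j ∈ soLie p q ℂ := by
  rw [mem_soLie_iff]
  rintro (⟨⟨⟩⟩ | i | ⟨⟨⟩⟩) (⟨⟨⟩⟩ | k | ⟨⟨⟩⟩) <;>
  simp [confForm_zero_mul, confForm_mid_mul, confForm_last_mul, raisingMatrix, confSign_mul_self]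
  all_goals split_ifs <;> simp

/-- The element of the nilradical with row `e_j` beside the entry `(0, 0)`. -/
def raisingElt (j : Fin (p + q - 2)) : soLie p q ℂ := ⟨raisingMatrix j, raisingMatrix_mem j⟩

/-- The matrix `diag(1, 0, …, 0, -1)`. -/
def gradingMatrix (p q : ℕ) : Matrix (ConfIdx p q) (ConfIdx p q) ℂ :=
  Matrix.of fun a b =>
    match a, b with
    | Sum.inl _, Sum.inl _ => 1
    | Sum.inr (Sum.inr _), Sum.inr (Sum.inr _) => -1
    | _, _ => 0

theorem gradingMatrix_mem (p q : ℕ) : gradingMatrix p q ∈ soLie p q ℂ := by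
  rw [mem_soLie_iff]
  rintro (⟨⟨⟩⟩ | i | ⟨⟨⟩⟩) (⟨⟨⟩⟩ | k | ⟨⟨⟩⟩) <;>
  simp [confForm_zero_mul, confForm_mid_mul, confForm_last_mul, gradingMatrix]

theorem confOp_raisingElt (lam : ℂ) (j : Fin (p + q - 2))
    (f : MvPolynomial (Fin (p + q - 2)) ℂ) :
    confOp lam (raisingElt j).1 f = besselOp (confSign p q ℂ) lam j f := by
  simp [confOp_apply, raisingElt, raisingMatrix]

theorem confOp_gradingMatrix (lam : ℂ) (f : MvPolynomial (Fin (p + q - 2)) ℂ) :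
    confOp lam (gradingMatrix p q) f = lam • f - eulerOp _ f := by
  simp [confOp_apply, gradingMatrix]

theorem confOp_loweringElt_single (lam : ℂ) (i : Fin (p + q - 2))
    (f : MvPolynomial (Fin (p + q - 2)) ℂ) :
    confOp lam (loweringElt (Pi.single i 1)).1 f = X i * f := by
  rw [confOp_loweringElt]
  simp [Pi.single_apply]

/-- Without singular vectors of positive degree there are no nontrivial invariant subspaces. -/
theorem eq_bot_or_eq_top_of_invariant (lam : ℂ)
    (hs : ∀ (m : ℕ) (f : MvPolynomial (Fin (p + q - 2)) ℂ), f.IsHomogeneous (m + 1) →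
      (∀ j, besselOp (confSign p q ℂ) lam j f = 0) → f = 0)
    (K : Submodule ℂ (MvPolynomial (Fin (p + q - 2)) ℂ))
    (hK : ∀ (Z : soLie p q ℂ), ∀ f ∈ K, confOp lam Z.1 f ∈ K) : K = ⊥ ∨ K = ⊤ := by
  refine or_iff_not_imp_left.2 fun hbot => ?_
  obtain ⟨f, ⟨hfK, hf0⟩, hmin⟩ : ∃ f, (f ∈ K ∧ f ≠ 0) ∧
      ∀ g ∈ K, g.totalDegree < f.totalDegree → g = 0 := by
    obtain ⟨f, hf⟩ := Submodule.exists_mem_ne_zero_of_ne_bot hbot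
    obtain ⟨g, hg, hm⟩ := (measure totalDegree).wf.has_min {g | g ∈ K ∧ g ≠ 0} ⟨f, hf⟩
    exact ⟨g, hg, fun k hk hlt => by_contra fun h0 => hm k ⟨hk, h0⟩ hlt⟩
  have hdeg : f.totalDegree = 0 := by
    by_contra h0
    have hpos := Nat.pos_of_ne_zero h0
    -- The grading element keeps this combination in `K`, and the top-degree part of `f` cancels in
    -- it; minimality then makes `f` homogeneous.
    have hE : (f.totalDegree : ℂ) • f - eulerOp _ f = 0 := by
      refine hmin _ ?_ (totalDegree_smul_sub_eulerOp_lt hpos)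
      have h1 := K.sub_mem (hK ⟨_, gradingMatrix_mem p q⟩ f hfK)
        (K.smul_mem (lam - f.totalDegree) hfK)
      rw [confOp_gradingMatrix] at h1
      convert h1 using 1
      module
    have hhom := isHomogeneous_of_eulerOp_eq (sub_eq_zero.1 hE).symm
    obtain ⟨m, hm⟩ := Nat.exists_eq_succ_of_ne_zero h0
    rw [hm] at hhom
    refine hf0 (hs m f hhom fun j => ?_)
    refine hmin _ ?_ ?_
    · rw [← confOp_raisingElt]
      exact hK _ f hfK
    · rw [hm]
      exact Nat.lt_succ_of_le (hhom.besselOp _ lam j).totalDegree_le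
  rw [totalDegree_eq_zero_iff_eq_C] at hdeg
  have hc : coeff 0 f ≠ 0 := fun h => hf0 (by rw [hdeg, h, C_0])
  have h1 (c : ℂ) : C c ∈ K := by
    have := K.smul_mem (c / coeff 0 f) hfK
    rwa [hdeg, smul_eq_C_mul, coeff_C, if_pos rfl, ← C_mul, div_mul_cancel₀ _ hc] at this
  rw [eq_top_iff]
  rintro g -
  induction g using MvPolynomial.induction_on with
  | C c => exact h1 c
  | add a b ha hb => exact K.add_mem ha hb
  | mul_X a i ha =>
    rw [mul_comm, ← confOp_loweringElt_single lam]
    exact hK _ a ha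

/-- The bracket of a nilradical element with `Z` stays in the nilradical, so it acts on `k` by a
combination of Bessel operators. -/
theorem confOp_parabolic_singular (lam : ℂ) {k : MvPolynomial (Fin (p + q - 2)) ℂ}
    (hk : constantCoeff k = 0) (hB : ∀ j, besselOp (confSign p q ℂ) lam j k = 0)
    {Z : soLie p q ℂ} (hZ : Z ∈ confParabolic p q) :
    constantCoeff (confOp lam Z.1 k) = 0 ∧
      ∀ j, besselOp (confSign p q ℂ) lam j (confOp lam Z.1 k) = 0 := by
  have hz (i) : Z.1 (idxMid i) idxZero = 0 := hZ _ (by simp)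
  constructor
  · simp [confOp_apply, hB, hk, eulerOp_apply, smul_eq_C_mul]
  · intro j
    have h := confOp_lie lam k (raisingElt j) Z
    rw [confOp_raisingElt, confOp_raisingElt, hB, map_zero, sub_zero] at h
    rw [← h, confOp_apply]
    have h1 (i) : (⁅raisingElt j, Z⁆ : soLie p q ℂ).1 (idxMid i) idxZero = 0 := by
      rw [soLie_coe_lie]
      simp [raisingElt, raisingMatrix, soLie_last_zero]
    have h2 : (⁅raisingElt j, Z⁆ : soLie p q ℂ).1 idxZero idxZero = 0 := by
      rw [soLie_coe_lie]
      simp [raisingElt, raisingMatrix, hz]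
    have h3 (i l) : (⁅raisingElt j, Z⁆ : soLie p q ℂ).1 (idxMid i) (idxMid l) = 0 := by
      rw [soLie_coe_lie]
      simp [raisingElt, raisingMatrix, soLie_last_mid, hz]
    simp [h1, h2, h3, hB]

/-- A nonzero singular vector without constant term generates a nontrivial invariant subspace. -/
theorem exists_invariant_of_singular (lam : ℂ) {k : MvPolynomial (Fin (p + q - 2)) ℂ}
    (hk0 : k ≠ 0) (hk : constantCoeff k = 0)
    (hB : ∀ j, besselOp (confSign p q ℂ) lam j k = 0) :
    ∃ K : Submodule ℂ (MvPolynomial (Fin (p + q - 2)) ℂ),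
      (∀ (Z : soLie p q ℂ), ∀ f ∈ K, confOp lam Z.1 f ∈ K) ∧ K ≠ ⊥ ∧ K ≠ ⊤ := by
  -- Taking all such vectors makes `S` stable under the parabolic subalgebra. Vanishing constant
  -- terms keep the ideal inside the augmentation ideal, hence proper.
  let S : Set (MvPolynomial (Fin (p + q - 2)) ℂ) :=
    {k | constantCoeff k = 0 ∧ ∀ j, besselOp (confSign p q ℂ) lam j k = 0}
  refine ⟨(Ideal.span S).restrictScalars ℂ, ?_, ?_, ?_⟩
  · have hmul (a : MvPolynomial (Fin (p + q - 2)) ℂ) (s) (hs : s ∈ S) (Z : soLie p q ℂ) :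
        confOp lam Z.1 (a * s) ∈ Ideal.span S := by
      induction a using MvPolynomial.induction_on generalizing Z with
      | C c =>
        have hZ : Z.1 = (Z - loweringElt fun i => Z.1 (idxMid i) idxZero).1 +
            (loweringElt fun i => Z.1 (idxMid i) idxZero).1 := (sub_add_cancel Z.1 _).symm
        rw [← smul_eq_C_mul, map_smul, smul_eq_C_mul]
        refine Ideal.mul_mem_left _ _ ?_
        rw [hZ, map_add, LinearMap.add_apply, confOp_loweringElt]
        refine add_mem (Ideal.subset_span
          (confOp_parabolic_singular lam hs.1 hs.2 (sub_loweringElt_mem Z))) ?_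
        refine sum_mem fun i _ => ?_
        rw [smul_eq_C_mul]
        exact Ideal.mul_mem_left _ _ (Ideal.mul_mem_left _ _ (Ideal.subset_span hs))
      | add a b ha hb => rw [add_mul, map_add]; exact add_mem (ha Z) (hb Z)
      | mul_X a i ha =>
        rw [mul_comm a, mul_assoc, confOp_X_mul]
        exact add_mem (Ideal.mul_mem_left _ _ (ha Z)) (ha _)
    -- The free multiplier `a` absorbs the polynomial coefficients in the span induction.
    have hmul' (f) (hf : f ∈ Ideal.span S) : ∀ (a : MvPolynomial (Fin (p + q - 2)) ℂ)
        (Z : soLie p q ℂ), confOp lam Z.1 (a * f) ∈ Ideal.span S := by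
      induction hf using Submodule.span_induction with
      | mem x hx => exact fun a Z => hmul a x hx Z
      | zero => intro a Z; rw [mul_zero, map_zero]; exact zero_mem _
      | add x y _ _ hx hy => intro a Z; rw [mul_add, map_add]; exact add_mem (hx a Z) (hy a Z)
      | smul b x _ hx => intro a Z; rw [smul_eq_mul, ← mul_assoc]; exact hx (a * b) Z
    intro Z f hf
    simpa using hmul' f hf 1 Z
  · intro h
    have h1 : k ∈ (Ideal.span S).restrictScalars ℂ := Ideal.subset_span ⟨hk, hB⟩
    rw [h, Submodule.mem_bot] at h1
    exact hk0 h1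
  · intro h
    have h1 : (1 : MvPolynomial (Fin (p + q - 2)) ℂ) ∈ (Ideal.span S).restrictScalars ℂ :=
      h ▸ Submodule.mem_top
    have h2 : Ideal.span S ≤ RingHom.ker (constantCoeff (R := ℂ)) :=
      Ideal.span_le.2 fun s hs => hs.1
    simpa using h2 h1

end InvariantSubspaces

/-! ### Explicit singular vectors -/

section SingularVectors

open MvPolynomial

variable {σ : Type*} [Fintype σ] (ε : σ → ℂ) (lam : ℂ)

/-- The quadratic form `∑ ε_i ξ_i ^ 2`. -/
noncomputable def signedQuadratic : MvPolynomial σ ℂ := ∑ i, C (ε i) * X i ^ 2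

theorem signedQuadratic_isHomogeneous : (signedQuadratic ε).IsHomogeneous 2 :=
  IsHomogeneous.sum _ _ _ fun i _ => (isHomogeneous_X_pow i 2).C_mul _

theorem pderiv_signedQuadratic (j : σ) :
    pderiv j (signedQuadratic ε) = 2 * C (ε j) * X j := by
  classical
  simp only [signedQuadratic, map_sum, pderiv_C_mul, pderiv_pow, pderiv_X, Pi.single_apply]
  rw [Finset.sum_eq_single j]
  · simp; ring
  · intro i _ hi
    simp [hi]
  · simp

theorem signedQuadratic_ne_zero [Nonempty σ] (hε : ∀ i, ε i * ε i = 1) :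
    signedQuadratic ε ≠ 0 := by
  classical
  obtain ⟨i⟩ := ‹Nonempty σ›
  intro h
  have h1 := congrArg (eval (Pi.single i 1)) h
  have h2 : ε i = 0 := by simpa [signedQuadratic, Pi.single_apply] using h1
  simpa [h2] using hε i

/-- Both terms of the Bessel operator are multiples of `ξ_j Q ^ k`, with total coefficient `2 (k +
1) ε_j (n / 2 + lam - (k + 1))`, where `n` is the number of variables. -/
theorem besselOp_signedQuadratic_pow (hε : ∀ i, ε i * ε i = 1) (k : ℕ)
    (hl : (Fintype.card σ : ℂ) / 2 + lam = (k + 1 : ℕ)) (j : σ) :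
    besselOp ε lam j (signedQuadratic ε ^ (k + 1)) = 0 := by
  have hd (i) : pderiv i (signedQuadratic ε ^ (k + 1)) =
      C (2 * (k + 1) * ε i) * (X i * signedQuadratic ε ^ k) := by
    rw [pderiv_pow, pderiv_signedQuadratic]
    simp only [map_mul, map_add, map_natCast, map_ofNat, map_one, Nat.cast_add, Nat.cast_one,
      Nat.add_sub_cancel]
    ring
  have hE : eulerOp σ (signedQuadratic ε ^ k) = ((2 * k : ℕ) : ℂ) • signedQuadratic ε ^ k :=
    ((signedQuadratic_isHomogeneous ε).pow k).eulerOp_eq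
  have hL : signedLaplacian ε (signedQuadratic ε ^ (k + 1)) =
      (2 * (k + 1) * (Fintype.card σ + 2 * k) : ℂ) • signedQuadratic ε ^ k := by
    have h1 (i) : ε i • pderiv i (pderiv i (signedQuadratic ε ^ (k + 1))) =
        (2 * (k + 1) : ℂ) • (signedQuadratic ε ^ k + X i * pderiv i (signedQuadratic ε ^ k)) := by
      rw [hd, pderiv_C_mul, pderiv_mul, pderiv_X_self, one_mul, ← smul_eq_C_mul, smul_smul]
      congr 1
      linear_combination (2 * (k + 1) : ℂ) * hε i
    rw [signedLaplacian_apply, Finset.sum_congr rfl fun i _ => h1 i, ← Finset.smul_sum,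
      Finset.sum_add_distrib, ← eulerOp_apply, hE, Finset.sum_const, Finset.card_univ,
      ← Nat.cast_smul_eq_nsmul ℂ, ← add_smul, smul_smul]
    push_cast
    rfl
  have hh : (signedQuadratic ε ^ (k + 1)).IsHomogeneous (2 * k + 1 + 1) :=
    (signedQuadratic_isHomogeneous ε).pow (k + 1)
  rw [besselOp_apply_of_isHomogeneous ε lam hh, hd, hL, mul_smul_comm, smul_smul,
    ← smul_eq_C_mul, smul_smul, ← add_smul]
  convert zero_smul ℂ _
  push_cast at hl ⊢
  linear_combination (2 * (k + 1) * ε j : ℂ) * hl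

/-- Powers of an isotropic linear form are harmonic, and in degree `m + 1` the factor `lam - m` is
zero. -/
theorem besselOp_isotropic_pow (d : σ → ℂ) (hd : ∑ i, ε i * (d i * d i) = 0) (m : ℕ) (j : σ) :
    besselOp ε m j ((∑ i, C (d i) * X i) ^ (m + 1)) = 0 := by
  classical
  set l : MvPolynomial σ ℂ := ∑ i, C (d i) * X i with hl
  have hp (i) : pderiv i l = C (d i) := by
    simp [hl, pderiv_X, Pi.single_apply]
  have hh : (l ^ (m + 1)).IsHomogeneous (m + 1) := by
    have h1 : l.IsHomogeneous 1 := IsHomogeneous.sum _ _ _ fun i _ => (isHomogeneous_X ℂ i).C_mul _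
    simpa using h1.pow (m + 1)
  have hL : signedLaplacian ε (l ^ (m + 1)) = 0 := by
    have h1 (i) : ε i • pderiv i (pderiv i (l ^ (m + 1))) =
        C (ε i * (d i * d i)) *
          (((m : MvPolynomial σ ℂ) + 1) * (m : MvPolynomial σ ℂ) * l ^ (m - 1)) := by
      have h2 : pderiv i (l ^ (m + 1)) = C (d i * (m + 1)) * l ^ m := by
        rw [pderiv_pow, hp]
        simp only [C_mul, map_add, map_natCast, map_one, Nat.cast_add, Nat.cast_one,
          Nat.add_sub_cancel]
        ring
      rw [h2, pderiv_C_mul, pderiv_pow, hp, smul_eq_C_mul]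
      simp only [C_mul, map_add, map_natCast, map_one]
      ring
    rw [signedLaplacian_apply, Finset.sum_congr rfl fun i _ => h1 i, ← Finset.sum_mul, ← map_sum,
      hd, C_0, zero_mul]
  rw [besselOp_apply_of_isHomogeneous ε _ hh, hL, sub_self, zero_smul, mul_zero, smul_zero,
    add_zero]

theorem exists_singular_of_nontrivial [Nontrivial σ] (hε : ∀ i, ε i * ε i = 1) (m : ℕ) :
    ∃ f : MvPolynomial σ ℂ, f ≠ 0 ∧ constantCoeff f = 0 ∧ ∀ j, besselOp ε m j f = 0 := by
  classical
  obtain ⟨a, b, hab⟩ := exists_pair_ne σ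
  -- Chosen so that `c ξ_a + ξ_b` is isotropic: `ε_a c ^ 2 + ε_b = 0`.
  obtain ⟨c, hc⟩ := IsAlgClosed.exists_pow_nat_eq (-(ε a * ε b)) (n := 2) (by norm_num)
  let d : σ → ℂ := Pi.single a c + Pi.single b 1
  have hda : d a = c := by simp [d, hab]
  have hdb : d b = 1 := by simp [d, hab.symm]
  refine ⟨(∑ i, C (d i) * X i) ^ (m + 1), pow_ne_zero _ fun h => ?_, by simp, fun j =>
    besselOp_isotropic_pow ε d ?_ m j⟩
  · have h1 := congrArg (eval (Pi.single b 1)) h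
    simp [Pi.single_apply, hdb] at h1
  · rw [Finset.sum_eq_add a b hab, hda, hdb]
    · linear_combination ε a * hc - ε b * hε a
    · intro i _ hi
      simp [d, hi.1, hi.2]
    · simp
    · simp

/-- In one variable no nonzero linear form is isotropic. Instead `B` sends `ξ ^ (2 m + 1)` to `(2 m
+ 1) (lam - m) ξ ^ (2 m)`, which vanishes at `lam = m`. -/
theorem exists_singular_of_subsingleton [Subsingleton σ] [Nonempty σ] (hε : ∀ i, ε i * ε i = 1)
    (m : ℕ) :
    ∃ f : MvPolynomial σ ℂ, f ≠ 0 ∧ constantCoeff f = 0 ∧ ∀ j, besselOp ε m j f = 0 := by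
  obtain ⟨i⟩ := ‹Nonempty σ›
  refine ⟨X i ^ (2 * m + 1), pow_ne_zero _ (X_ne_zero i), by simp, fun j => ?_⟩
  obtain rfl := Subsingleton.elim i j
  have hh : (X i ^ (2 * m + 1) : MvPolynomial σ ℂ).IsHomogeneous (2 * m + 1) :=
    isHomogeneous_X_pow i _
  rw [besselOp_apply_of_isHomogeneous ε _ hh, signedLaplacian_apply, Fintype.sum_subsingleton _ i]
  have hd : pderiv i (X i ^ (2 * m + 1) : MvPolynomial σ ℂ) =
      C (2 * m + 1 : ℂ) * X i ^ (2 * m) := by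
    rw [pderiv_pow, pderiv_X_self, Nat.add_sub_cancel, mul_one]
    simp only [map_mul, map_natCast, map_ofNat, Nat.cast_add, Nat.cast_one, Nat.cast_mul,
      Nat.cast_ofNat, map_add, map_one]
  have hd2 : X i * pderiv i (X i ^ (2 * m) : MvPolynomial σ ℂ) = C (2 * m : ℂ) * X i ^ (2 * m) := by
    rw [pderiv_pow, pderiv_X_self]
    cases m with
    | zero => simp
    | succ m =>
      rw [show 2 * (m + 1) = 2 * m + 1 + 1 by ring, Nat.add_sub_cancel, pow_succ _ (2 * m + 1)]
      simp only [map_mul, map_natCast, map_ofNat, Nat.cast_add, Nat.cast_one, Nat.cast_mul,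
        Nat.cast_ofNat, map_add, map_one]
      ring
  rw [hd, pderiv_C_mul, mul_smul_comm, mul_left_comm, hd2, ← smul_eq_C_mul, ← smul_eq_C_mul,
    ← smul_eq_C_mul, smul_smul, smul_smul, smul_smul, smul_smul, ← add_smul]
  convert zero_smul ℂ _
  push_cast
  linear_combination (m * (2 * m + 1) : ℂ) * hε i

end SingularVectors

end

theorem mainTheorem9 (p q n : ℕ) (hp : 1 ≤ p) (hq : 2 ≤ q) (hn : n = p + q - 2) (lam : ℂ) :
    (Even n →
      (IsSimpleModule (UniversalEnvelopingAlgebra ℂ (soLie p q ℂ)) (ScalarVermaModule p q lam) ↔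
        ¬ ∃ m : ℕ, 1 ≤ m ∧ (n : ℂ) / 2 + lam = m)) ∧
    (Odd n →
      (IsSimpleModule (UniversalEnvelopingAlgebra ℂ (soLie p q ℂ)) (ScalarVermaModule p q lam) ↔
        (¬ ∃ m : ℕ, lam = m) ∧ ¬ ∃ m : ℕ, 1 ≤ m ∧ (n : ℂ) / 2 + lam = m)) := by
  have hn1 : 1 ≤ n := by omega
  have hcard : Fintype.card (Fin (p + q - 2)) = n := by rw [Fintype.card_fin, hn]
  have hne : Nonempty (Fin (p + q - 2)) := ⟨⟨0, by omega⟩⟩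
  have hnt : 2 ≤ n → Nontrivial (Fin (p + q - 2)) := fun h => by
    rw [← Fintype.one_lt_card_iff_nontrivial, hcard]; exact h
  rw [isSimpleModule_scalarVermaModule_iff]
  have hred {k : MvPolynomial (Fin (p + q - 2)) ℂ} (hk0 : k ≠ 0)
      (hk : MvPolynomial.constantCoeff k = 0)
      (hB : ∀ j, besselOp (confSign p q ℂ) lam j k = 0) :
      ¬ ∀ K : Submodule ℂ (MvPolynomial (Fin (p + q - 2)) ℂ),
        (∀ (Z : soLie p q ℂ), ∀ f ∈ K, confOp lam Z.1 f ∈ K) → K = ⊥ ∨ K = ⊤ := by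
    obtain ⟨K, hK, hbot, htop⟩ := exists_invariant_of_singular lam hk0 hk hB
    exact fun h => (h K hK).elim hbot htop
  have hred1 (hl : ∃ m : ℕ, 1 ≤ m ∧ (n : ℂ) / 2 + lam = m) :
      ¬ ∀ K : Submodule ℂ (MvPolynomial (Fin (p + q - 2)) ℂ),
        (∀ (Z : soLie p q ℂ), ∀ f ∈ K, confOp lam Z.1 f ∈ K) → K = ⊥ ∨ K = ⊤ := by
    obtain ⟨m, hm, hl⟩ := hl
    obtain ⟨k, rfl⟩ := Nat.exists_eq_add_of_le' hm
    refine hred (pow_ne_zero (k + 1) (signedQuadratic_ne_zero (confSign p q ℂ) confSign_mul_self))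
      ?_ (besselOp_signedQuadratic_pow _ lam confSign_mul_self k (by rw [hcard, hl]))
    simp [signedQuadratic]
  have hirr (h1 : ¬ ∃ m : ℕ, lam = m) (h2 : ¬ ∃ m : ℕ, 1 ≤ m ∧ (n : ℂ) / 2 + lam = m)
      (K : Submodule ℂ (MvPolynomial (Fin (p + q - 2)) ℂ))
      (hK : ∀ (Z : soLie p q ℂ), ∀ f ∈ K, confOp lam Z.1 f ∈ K) : K = ⊥ ∨ K = ⊤ := by
    refine eq_bot_or_eq_top_of_invariant lam (fun m f hf hB => ?_) K hK
    by_contra hf0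
    rcases parameter_of_besselOp_eq_zero _ lam confSign_mul_self hf hf0 hB with h | ⟨h, hm⟩
    · exact h1 ⟨m, h⟩
    · rw [hcard] at h
      rcases Nat.even_or_odd (m + 1) with ⟨t, ht⟩ | ho
      · refine h2 ⟨t, by omega, ?_⟩
        rw [ht] at h
        push_cast at h
        linear_combination h / 2
      -- Odd degree is excluded for `n ≥ 2`; for `n = 1` the relation reads `2 lam = (2 t + 1) - 1`.
      · have h3 : n = 1 := by
          by_contra h3
          exact Nat.not_even_iff_odd.2 ho (hm (hnt (by omega)))
        obtain ⟨t, ht⟩ := ho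
        refine h1 ⟨t, ?_⟩
        rw [ht, h3] at h
        push_cast at h
        linear_combination h / 2
  refine ⟨fun he => ⟨fun h hl => hred1 hl h, fun h2 => hirr ?_ h2⟩,
    fun ho => ⟨fun h => ⟨?_, fun hl => hred1 hl h⟩, fun h => hirr h.1 h.2⟩⟩
  -- For even `n`, `lam ∈ ℕ` already makes `n / 2 + lam` a positive integer, as `n ≥ 2`.
  · rintro ⟨m, rfl⟩
    obtain ⟨t, rfl⟩ := he
    refine h2 ⟨t + m, by omega, ?_⟩
    push_cast
    ring
  · rintro ⟨m, rfl⟩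
    have hex : ∃ f : MvPolynomial (Fin (p + q - 2)) ℂ, f ≠ 0 ∧
        MvPolynomial.constantCoeff f = 0 ∧ ∀ j, besselOp (confSign p q ℂ) m j f = 0 := by
      by_cases h2 : 2 ≤ n
      · have := hnt h2
        exact exists_singular_of_nontrivial _ confSign_mul_self m
      · have : Subsingleton (Fin (p + q - 2)) := by
          rw [← Fintype.card_le_one_iff_subsingleton, hcard]; omega
        exact exists_singular_of_subsingleton _ confSign_mul_self m
    obtain ⟨f, hf0, hf, hB⟩ := hex
    exact hred hf0 hf hB h
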